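/- Let $G$ be a compact connected Lie group with Lie algebra $\mathfrak g$, let $(\cdot,\cdot)$ be an $\mathrm{Ad}$-invariant inner product on $\mathfrak g$, and let $\Lambda\in\mathfrak g$. Let $O(\Lambda)=\{\mathrm{Ad}(g)\Lambda : g\in G\}$ be the adjoint orbit, with tangent spaces $T_ZO(\Lambda)=\{[X,Z] : X\in\mathfrak g\}$ and with the symplectic form $\omega_Z([X,Z],[Y,Z])=-(Z,[X,Y])$. The Hamiltonian vector field $X_H$ of a smooth function $H$ on $O(\Lambda)$ is defined by $dH+\iota_{X_H}\omega=0$. Let $K\subset G$ be a closed connected Lie subgroup with Lie algebra $\mathfrak k$ (with the induced inner product), let $\pi_K:\mathfrak g\to\mathfrak k$ be the orthogonal projection, and let $\Phi_K=\pi_K|_{O(\Lambda)}:O(\Lambda)\to\mathfrak k$ be the moment map of the $K$-action. For $F\in C^\infty(\mathfrak k)$ define $\nabla F:\mathfrak k\to\mathfrak k$ by $dF_X(Y)=(Y,\nabla F(X))$, and put $L_K=\Phi_K$, $P_K=\nabla F(\Phi_K)$. (1) For every $F\in C^\infty(\mathfrak k)$ the Hamiltonian system $(O(\Lambda),\omega,F\circ\Phi_K)$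 is completely determined by the Lax equation $$\frac{d}{dt}L_K+[L_K,P_K]=0,$$ in the following sense. The Hamiltonian vector field exists, is unique, and is $Z\mapsto[P_K(Z),Z]$; through every $Z\in O(\Lambda)$ there is exactly one integral curve $\gamma:\mathbb R\to O(\Lambda)$ with $\gamma(0)=Z$. Along every integral curve $\gamma$ the Lax equation holds for $L_K(\gamma(t))$, $P_K(\gamma(t))$, and for every $J\in C^\infty(\mathfrak k)$ $$\frac{d}{dt}J(\Phi_K(\gamma(t)))=\bigl(\nabla J(L_K(\gamma(t))),\,-[L_K(\gamma(t)),P_K(\gamma(t))]\bigr).$$ Moreover, if $\ell:\mathbb R\to\mathfrak k$ solves $\ell'+[\ell,\nabla F(\ell)]=0$ with $\ell(0)=L_K(\gamma(0))$, then $\ell(t)=L_K(\gamma(t))$ for all $t$, and $\gamma$ is the only solution $c:\mathbb R\to\mathfrak g$ of $c'=[\nabla F(\ell),c]$, $c(0)=\gamma(0)$. (2) There is a connected open dense subset $\mathcal U_K\subset O(\Lambda)$ such that for every finite-dimensional (smooth) unitary representation $\varrho:K\to\mathrm{GL}(V)$, with differential $\varrho_*:\mathfrak k\to\mathfrak{gl}(V)$,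 and every $m\in\mathbb N$, the function $$Z\mapsto(\sqrt{-1})^m\,\mathrm{Tr}\bigl([\varrho_*(L_K(Z))]^m\bigr)$$ is real-valued on $\mathcal U_K$, and for every $F\in C^\infty(\mathfrak k)$ the integral curves $\gamma$ of the Hamiltonian system of $F\circ\Phi_K$ that start in $\mathcal U_K$ stay in $\mathcal U_K$, these functions are constant along $\gamma$, and the spectral equation $\det\bigl(w\mathbf 1_V-\varrho_*(L_K(Z))\bigr)=0$ is preserved along $\gamma$: for every $w\in\mathbb C$ the determinant $\det\bigl(w\mathbf 1_V-\varrho_*(L_K(\gamma(t)))\bigr)$ does not depend on $t$. -/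

import Mathlib

open Set
open scoped Manifold ContDiff InnerProductSpace

noncomputable section

/-- The Lie algebra `𝔤 = T₁G` of a Lie group `G` modelled on `E`: Mathlib realizes the tangent
space at the identity on the model space `E`. -/
abbrev LieAlg (E : Type*) (_G : Type*) : Type _ := E

section LieGroup

variable {E : Type*} [NormedAddCommGroup E] [NormedSpace ℝ E]
variable (G : Type*) [TopologicalSpace G] [ChartedSpace E G] [Group G]

/-- The Lie bracket of `𝔤 = T₁G` (the bracket at `1` of left-invariant vector fields). -/
def lieBr (X Y : LieAlg E G) : LieAlg E G :=
  (⁅(show GroupLieAlgebra 𝓘(ℝ, E) G from X), (show GroupLieAlgebra 𝓘(ℝ, E) G from Y)⁆ :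
    GroupLieAlgebra 𝓘(ℝ, E) G)

variable {G}

/-- The adjoint action `Ad g : 𝔤 → 𝔤`, the differential at `1` of `x ↦ g x g⁻¹`. -/
def Ad (g : G) : LieAlg E G →L[ℝ] LieAlg E G :=
  mfderiv 𝓘(ℝ, E) 𝓘(ℝ, E) (fun x : G => g * x * g⁻¹) (1 : G)

/-- The adjoint orbit `O(Λ)`. -/
def adOrbit (Λ : LieAlg E G) : Set (LieAlg E G) := {Z | ∃ g : G, Z = Ad g Λ}

/-- The tangent space `{[X, Z] | X ∈ 𝔤}` at `Z` of the adjoint orbit through `Z`. -/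
def orbitTangent (Z : LieAlg E G) : Set (LieAlg E G) := {U | ∃ X : LieAlg E G, lieBr G X Z = U}

variable (E G)

/-- An `Ad`-invariant inner product on `𝔤`. -/
structure AdInvariantInner where
  form : LieAlg E G →ₗ[ℝ] LieAlg E G →ₗ[ℝ] ℝ
  symm : ∀ X Y, form X Y = form Y X
  pos : ∀ X, X ≠ 0 → 0 < form X X
  invariant : ∀ (g : G) (X Y : LieAlg E G), form (Ad g X) (Ad g Y) = form X Y

variable {E G}

open Classical in
/-- The Kirillov-Kostant-Souriau form on the adjoint orbit through `Z`, given on tangent vectors by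
`ω_Z([X, Z], [Y, Z]) = -(Z, [X, Y])` (for an invariant inner product this does not depend on the
choice of `X` and `Y`). -/
def kks (B : AdInvariantInner E G) (Z U V : LieAlg E G) : ℝ :=
  if h : U ∈ orbitTangent (G := G) Z ∧ V ∈ orbitTangent (G := G) Z then
    -(B.form Z (lieBr G h.1.choose h.2.choose))
  else 0

/-- `v` is the value at `Z` of the Hamiltonian vector field `X_H` of the restriction of `H` to the
adjoint orbit through `Z`: it is tangent to the orbit, and `dH + ι_{X_H} ω = 0` at `Z`. -/
def IsHamiltonianVector (B : AdInvariantInner E G) (H : LieAlg E G → ℝ) (Z v : LieAlg E G) : Prop :=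
  v ∈ orbitTangent (G := G) Z ∧
    ∀ W ∈ orbitTangent (G := G) Z, fderiv ℝ H Z W + kks B Z v W = 0

/-- `γ` is a (complete) integral curve of the Hamiltonian system `(O(Λ), ω, H)`. -/
def IsHamiltonianTrajectory (B : AdInvariantInner E G) (Λ : LieAlg E G) (H : LieAlg E G → ℝ)
    (γ : ℝ → LieAlg E G) : Prop :=
  ∀ t, γ t ∈ adOrbit (G := G) Λ ∧ ∃ v, IsHamiltonianVector B H (γ t) v ∧ HasDerivAt γ v t

variable (G)

/-- The Lax equation `L' + [L, P] = 0` for curves in a Lie algebra. -/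
def SatisfiesLax (L P : ℝ → LieAlg E G) : Prop :=
  ∀ t, DifferentiableAt ℝ L t ∧ deriv L t + lieBr G (L t) (P t) = 0

end LieGroup

section Riesz

variable {V : Type*} [AddCommGroup V] [Module ℝ V]

open Classical in
/-- The vector `v` with `b v w = φ w` for all `w`. -/
def riesz (b : V →ₗ[ℝ] V →ₗ[ℝ] ℝ) (φ : V →ₗ[ℝ] ℝ) : V :=
  if h : ∃ v, ∀ w, b v w = φ w then h.choose else 0

theorem riesz_spec [FiniteDimensional ℝ V] (b : V →ₗ[ℝ] V →ₗ[ℝ] ℝ)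
    (hb : ∀ X, X ≠ 0 → 0 < b X X) (φ : V →ₗ[ℝ] ℝ) (w : V) : b (riesz b φ) w = φ w := by
  have hinj : Function.Injective b := by
    rw [← LinearMap.ker_eq_bot, LinearMap.ker_eq_bot']
    intro x hx
    by_contra h
    have := hb x h
    simp [hx] at this
  have hsurj : Function.Surjective b :=
    (LinearMap.injective_iff_surjective_of_finrank_eq_finrank
      (Subspace.dual_finrank_eq (K := ℝ) (V := V)).symm).1 hinj
  have h : ∃ v, ∀ w, b v w = φ w := by
    obtain ⟨v, hv⟩ := hsurj φ
    exact ⟨v, fun w => by rw [hv]⟩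
  rw [riesz, dif_pos h]
  exact h.choose_spec w

theorem riesz_unique [FiniteDimensional ℝ V] (b : V →ₗ[ℝ] V →ₗ[ℝ] ℝ)
    (hb : ∀ X, X ≠ 0 → 0 < b X X) (φ : V →ₗ[ℝ] ℝ) (v : V) (hv : ∀ w, b v w = φ w) :
    riesz b φ = v := by
  by_contra h
  have := hb _ (sub_ne_zero.2 h)
  simp [riesz_spec b hb φ, hv] at this

end Riesz

section Subgroup

variable {E : Type*} [NormedAddCommGroup E] [NormedSpace ℝ E]
variable {G : Type*} [TopologicalSpace G] [ChartedSpace E G] [Group G]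
variable {EK : Type*} [NormedAddCommGroup EK] [NormedSpace ℝ EK]

/-- A subgroup `K ⊂ G` with a manifold structure is a Lie subgroup if the inclusion is a smooth
immersion. -/
structure IsLieSubgroup (K : Subgroup G) [ChartedSpace EK K] : Prop where
  contMDiff_val : ContMDiff 𝓘(ℝ, EK) 𝓘(ℝ, E) ∞ (Subtype.val : K → G)
  mfderiv_injective : ∀ k : K,
    Function.Injective (mfderiv 𝓘(ℝ, EK) 𝓘(ℝ, E) (Subtype.val : K → G) k)

variable (K : Subgroup G) [ChartedSpace EK K]

/-- The inclusion `𝔨 → 𝔤` of Lie algebras, the differential at `1` of `K → G`. -/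
def lieIncl : LieAlg EK K →L[ℝ] LieAlg E G :=
  mfderiv 𝓘(ℝ, EK) 𝓘(ℝ, E) (Subtype.val : K → G) (1 : K)

variable {K}

/-- The restriction to `𝔨` of the inner product of `𝔤`. -/
def subForm (B : AdInvariantInner E G) (K : Subgroup G) [ChartedSpace EK K] :
    LieAlg EK K →ₗ[ℝ] LieAlg EK K →ₗ[ℝ] ℝ :=
  B.form.compl₁₂ (lieIncl (E := E) (EK := EK) K).toLinearMap (lieIncl (E := E) (EK := EK) K).toLinearMap

/-- The moment map `Φ_K : 𝔤 → 𝔨` (to be restricted to `O(Λ)`): the orthogonal projection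
`π_K`, so that `(Φ_K(Z), Y) = (Z, Y)` for all `Y ∈ 𝔨`. -/
def momentMap (B : AdInvariantInner E G) (K : Subgroup G) [ChartedSpace EK K]
    (Z : LieAlg E G) : LieAlg EK K :=
  riesz (subForm B K) ((B.form Z).comp (lieIncl (E := E) (EK := EK) K).toLinearMap)

/-- The gradient of `F : 𝔨 → ℝ`: `dF_X(Y) = (Y, ∇F(X))` for all `Y ∈ 𝔨`. -/
def lieGrad (B : AdInvariantInner E G) (K : Subgroup G) [ChartedSpace EK K]
    (F : LieAlg EK K → ℝ) (X : LieAlg EK K) : LieAlg EK K :=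
  riesz (subForm B K) (fderiv ℝ F X : EK →ₗ[ℝ] ℝ)

end Subgroup

section Representation

variable {EK : Type*} [NormedAddCommGroup EK] [NormedSpace ℝ EK]
variable {K : Type*} [TopologicalSpace K] [ChartedSpace EK K] [Group K]
variable {V : Type*} [NormedAddCommGroup V] [InnerProductSpace ℂ V]

/-- The operators of a unitary representation. -/
def repOp (ρ : K →* (V ≃ₗᵢ[ℂ] V)) (k : K) : V →L[ℂ] V :=
  ((ρ k).toContinuousLinearEquiv : V →L[ℂ] V)

/-- The representation is smooth, as a map into `End V`. -/
def IsSmoothRep (ρ : K →* (V ≃ₗᵢ[ℂ] V)) : Prop :=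
  ContMDiff 𝓘(ℝ, EK) 𝓘(ℝ, V →L[ℂ] V) ∞ (repOp ρ)

/-- The induced representation `ρ_* : 𝔨 → 𝔤𝔩(V)`, the differential of `ρ` at `1`. -/
def repDeriv (ρ : K →* (V ≃ₗᵢ[ℂ] V)) : LieAlg EK K →L[ℝ] (V →L[ℂ] V) :=
  mfderiv 𝓘(ℝ, EK) 𝓘(ℝ, V →L[ℂ] V) (repOp ρ) (1 : K)

end Representation

end

/-! Everything rests on invariance: `Ad g` preserves the form, so each `ad X` is skew
(`AdInvariantInner.form_lieBr_left`). Hence the symplectic form on `[X, Z]`, `[Y, Z]` equals `([X,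
Z], Y)` (`kks_apply`). As `Y` is arbitrary, it is nondegenerate. The gradient of `F ∘ Φ_K` on the
ambient Lie algebra is `P_K`, because pairing `Φ_K(W)` with an element of `𝔨` is the same as pairing
`W` with it. Comparing the two gives the Hamiltonian field `Z ↦ [P_K(Z), Z]`
(`isHamiltonianVector_iff`). Skewness also gives `Φ_K([X, Z]) = [X, Φ_K(Z)]` for `X ∈ 𝔨`
(`momentMap_lieBr`), which turns this equation into the Lax equation.

For existence, the equation is lifted to `K`: a curve with velocity `k · w(k)`, for a suitable `w :
K → 𝔨`, makes `Ad(k⁻¹)Z` a trajectory. It exists for all time because `K` is compact, and the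
trajectory stays in the orbit by construction. Uniqueness is that of an ordinary differential
equation on the vector space. So every trajectory moves by `Ad(K)`, `L_K` moves by conjugation, and
the matrices `ρ_*(L_K)` stay similar; their traces and characteristic polynomials are constant. No
regularity of points is needed, so the whole orbit serves as the open dense set.

The analytic input is that the differential of `Ad` is the bracket of left-invariant fields
(`hasMFDerivAt_Ad_apply`), proved from the second derivative of the multiplication in a chart at
`1`. -/

/-! ### Completeness and uniqueness of integral curves -/

section IntegralCurves

open Filter Topology Metric

variable {E : Type*} [NormedAddCommGroup E] [NormedSpace ℝ E] [CompleteSpace E]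

/-- The local solutions of an autonomous `C¹` differential equation starting near `x₀` exist on a
common time interval and stay in a prescribed neighbourhood of `x₀`. -/
theorem ContDiffAt.exists_eventually_forall_hasDerivAt_mem {f : E → E} {x₀ : E}
    (hf : ContDiffAt ℝ 1 f x₀) {s : Set E} (hs : s ∈ 𝓝 x₀) :
    ∃ ε > (0 : ℝ), ∀ᶠ x in 𝓝 x₀, ∃ α : ℝ → E, α 0 = x ∧
      ∀ t ∈ Ioo (-ε) ε, HasDerivAt α (f (α t)) t ∧ α t ∈ s := by
  obtain ⟨δ, hδ, a, r, L, K, hr, hpl⟩ := IsPicardLindelof.of_contDiffAt_one hf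
  obtain ⟨α, hα, hcont⟩ := (hpl 0).exists_forall_mem_closedBall_eq_hasDerivWithinAt_continuousOn
  have hr' : (0 : ℝ) < r := hr
  have hx₀ : x₀ ∈ closedBall x₀ (r : ℝ) := mem_closedBall_self hr'.le
  have hnhds : closedBall x₀ (r : ℝ) ×ˢ Icc (0 - δ) (0 + δ) ∈ 𝓝 (x₀, (0 : ℝ)) :=
    prod_mem_nhds (closedBall_mem_nhds _ hr') (Icc_mem_nhds (by linarith) (by linarith))
  -- Joint continuity of the local flow at `(x₀, 0)` makes the time spent in `s` uniform in the
  -- starting point.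
  have hpre : α ⁻¹' s ∈ 𝓝 (x₀, (0 : ℝ)) := by
    apply (hcont.continuousAt hnhds).preimage_mem_nhds
    rwa [(hα x₀ hx₀).1]
  rw [nhds_prod_eq, mem_prod_iff] at hpre
  obtain ⟨u, hu, v, hv, huv⟩ := hpre
  obtain ⟨η, hη, hηv⟩ := Metric.mem_nhds_iff.1 hv
  refine ⟨min δ η, lt_min hδ hη, ?_⟩
  filter_upwards [hu, closedBall_mem_nhds x₀ hr'] with x hxu hx
  refine ⟨fun t => α (x, t), (hα x hx).1, fun t ht => ⟨?_, ?_⟩⟩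
  · have h1 : -δ < t := by linarith [ht.1, min_le_left δ η]
    have h2 : t < δ := ht.2.trans_le (min_le_left _ _)
    exact ((hα x hx).2 t ⟨by linarith, by linarith⟩).hasDerivAt
      (Icc_mem_nhds (by linarith) (by linarith))
  · apply huv (show (x, t) ∈ u ×ˢ v from ⟨hxu, hηv ?_⟩)
    rw [mem_ball, Real.dist_eq, sub_zero, abs_lt]
    exact ⟨by linarith [ht.1, min_le_right δ η], ht.2.trans_le (min_le_right _ _)⟩

variable {M : Type*} [TopologicalSpace M] [ChartedSpace E M] [IsManifold 𝓘(ℝ, E) 1 M]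

/-- The integral curves of a `C¹` vector field starting near a point exist on a common time
interval. -/
theorem exists_eventually_isMIntegralCurveOn_Ioo {v : (x : M) → TangentSpace 𝓘(ℝ, E) x} {x₀ : M}
    (hv : ContMDiffAt 𝓘(ℝ, E) 𝓘(ℝ, E).tangent 1
      (fun x => (⟨x, v x⟩ : TangentBundle 𝓘(ℝ, E) M)) x₀) :
    ∃ ε > (0 : ℝ), ∀ᶠ x in 𝓝 x₀, ∃ γ : ℝ → M, γ 0 = x ∧
      IsMIntegralCurveOn γ v (Ioo (-ε) ε) := by
  rw [contMDiffAt_iff] at hv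
  obtain ⟨_, hv⟩ := hv
  obtain ⟨ε, hε, hf⟩ := (hv.contDiffAt (by simp)).snd.exists_eventually_forall_hasDerivAt_mem
    (extChartAt_target_mem_nhds (I := 𝓘(ℝ, E)) x₀)
  refine ⟨ε, hε, ?_⟩
  filter_upwards [(continuousAt_extChartAt (I := 𝓘(ℝ, E)) x₀).eventually hf,
    extChartAt_source_mem_nhds (I := 𝓘(ℝ, E)) x₀] with x ⟨f, hf0, hf⟩ hx
  refine ⟨(extChartAt 𝓘(ℝ, E) x₀).symm ∘ f, ?_, ?_⟩
  · rw [Function.comp_apply, hf0, PartialEquiv.left_inv _ hx]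
  intro t ht
  let y : M := (extChartAt 𝓘(ℝ, E) x₀).symm (f t)
  have h : HasDerivAt f (x := t) <| fderivWithin ℝ
    (extChartAt 𝓘(ℝ, E) x₀ ∘ (extChartAt 𝓘(ℝ, E) y).symm)
    (range 𝓘(ℝ, E)) (extChartAt 𝓘(ℝ, E) y y) (v y) := (hf t ht).1
  rw [← tangentCoordChange_def] at h
  have hf3 := (hf t ht).2
  have hft1 := (extChartAt 𝓘(ℝ, E) x₀).map_target hf3
  have hft2 := mem_extChartAt_source (I := 𝓘(ℝ, E)) y
  -- `f` solves the equation in the chart at `x₀`, but the manifold derivative at time `t` is read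
  -- in the chart at `y`; the coordinate change between the two cancels.
  have hcomp : HasFDerivAt (extChartAt 𝓘(ℝ, E) y ∘ (extChartAt 𝓘(ℝ, E) x₀).symm)
      (tangentCoordChange 𝓘(ℝ, E) x₀ y y) (f t) := by
    apply HasFDerivWithinAt.hasFDerivAt (s := range 𝓘(ℝ, E)) _ (by simp)
    rw [← (extChartAt 𝓘(ℝ, E) x₀).right_inv hf3]
    exact hasFDerivWithinAt_tangentCoordChange ⟨hft1, hft2⟩
  have hvy : ∀ w : E, tangentCoordChange 𝓘(ℝ, E) x₀ y y (tangentCoordChange 𝓘(ℝ, E) y x₀ y w) = w :=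
    fun w => by
      rw [tangentCoordChange_comp (x := x₀) ⟨⟨hft2, hft1⟩, hft2⟩, tangentCoordChange_self hft2]
  have h' := hcomp.comp_hasDerivAt (f := f) (f' := (tangentCoordChange 𝓘(ℝ, E) y x₀ y (v y) : E)) t h
  replace h' := (hvy (v y)) ▸ h'
  refine HasMFDerivAt.hasMFDerivWithinAt
    ⟨(continuousAt_extChartAt_symm'' hf3).comp (f := f) (HasDerivAt.continuousAt
      (f' := (tangentCoordChange 𝓘(ℝ, E) y x₀ y (v y) : E)) h), ?_⟩
  exact h'.hasFDerivAt.hasFDerivWithinAt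

/-- A `C¹` vector field on a compact manifold is complete. -/
theorem exists_isMIntegralCurve_of_compactSpace [T2Space M] [CompactSpace M]
    {v : (x : M) → TangentSpace 𝓘(ℝ, E) x}
    (hv : ContMDiff 𝓘(ℝ, E) 𝓘(ℝ, E).tangent 1
      (fun x => (⟨x, v x⟩ : TangentBundle 𝓘(ℝ, E) M))) (x : M) :
    ∃ γ : ℝ → M, γ 0 = x ∧ IsMIntegralCurve γ v := by
  choose ε hε h using fun x => exists_eventually_isMIntegralCurveOn_Ioo (hv x)
  obtain ⟨s, -, hs⟩ := isCompact_univ.elim_nhds_subcover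
    (fun x => {y | ∃ γ : ℝ → M, γ 0 = y ∧ IsMIntegralCurveOn γ v (Ioo (-ε x) (ε x))})
    (fun x _ => h x)
  obtain ⟨y, hy, -⟩ := mem_iUnion₂.1 (hs (mem_univ x))
  have hne : s.Nonempty := ⟨y, hy⟩
  -- The least of the finitely many times is an existence time valid at every point, and a uniform
  -- time suffices for global curves.
  refine exists_isMIntegralCurve_of_isMIntegralCurveOn hv (ε := s.inf' hne ε)
    ((Finset.lt_inf'_iff hne).2 fun z _ => hε z) (fun z => ?_) x
  obtain ⟨w, hw, γ, hγ0, hγ⟩ := mem_iUnion₂.1 (hs (mem_univ z))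
  have hle := Finset.inf'_le ε hw
  exact ⟨γ, hγ0, hγ.mono (Ioo_subset_Ioo (neg_le_neg hle) hle)⟩

end IntegralCurves

/-- Global solutions of an autonomous `C¹` differential equation are determined by their initial
value. -/
theorem ContDiff.eq_of_forall_hasDerivAt {E : Type*} [NormedAddCommGroup E]
    [NormedSpace ℝ E] {f : E → E} (hf : ContDiff ℝ 1 f) {γ γ' : ℝ → E}
    (hγ : ∀ t, HasDerivAt γ (f (γ t)) t) (hγ' : ∀ t, HasDerivAt γ' (f (γ' t)) t)
    (h : γ 0 = γ' 0) : γ = γ' := by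
  refine isMIntegralCurve_Ioo_eq_of_contMDiff_boundaryless (I := 𝓘(ℝ, E)) (t₀ := 0)
    (v := f) ?_ (fun t => (hγ t).hasFDerivAt.hasMFDerivAt)
    (fun t => (hγ' t).hasFDerivAt.hasMFDerivAt) h
  exact contMDiff_vectorSpace_iff_contDiff.2 hf

section ChainRule

variable {E E' E'' : Type*} [NormedAddCommGroup E] [NormedSpace ℝ E] [NormedAddCommGroup E']
  [NormedSpace ℝ E'] [NormedAddCommGroup E''] [NormedSpace ℝ E'']
variable {M M' M'' : Type*} [TopologicalSpace M] [ChartedSpace E M] [TopologicalSpace M']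
  [ChartedSpace E' M'] [TopologicalSpace M''] [ChartedSpace E'' M'']

/-- The chain rule, with derivatives considered as maps of the model spaces. -/
theorem hasMFDerivAt_comp_of_eq {g : M' → M''} {f : M → M'} {x : M} {y : M'} {g' : E' →L[ℝ] E''}
    {f' : E →L[ℝ] E'} (hg : HasMFDerivAt 𝓘(ℝ, E') 𝓘(ℝ, E'') g y g')
    (hf : HasMFDerivAt 𝓘(ℝ, E) 𝓘(ℝ, E') f x f') (hy : f x = y) :
    HasMFDerivAt 𝓘(ℝ, E) 𝓘(ℝ, E'') (g ∘ f) x (g'.comp f' : E →L[ℝ] E'') := by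
  subst hy
  exact hg.comp x hf

theorem hasMFDerivAt_unique_apply {f : M → M'} {x : M} {f₁ f₂ : E →L[ℝ] E'}
    (h₁ : HasMFDerivAt 𝓘(ℝ, E) 𝓘(ℝ, E') f x f₁) (h₂ : HasMFDerivAt 𝓘(ℝ, E) 𝓘(ℝ, E') f x f₂)
    (v : E) : f₁ v = f₂ v :=
  congrArg (fun T : E →L[ℝ] E' => T v) (hasMFDerivAt_unique h₁ h₂)

end ChainRule

/-! ### The adjoint representation and its differential -/

section Adjoint

open Filter Topology VectorField

variable {E : Type*} [NormedAddCommGroup E] [NormedSpace ℝ E]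
variable {G : Type*} [TopologicalSpace G] [ChartedSpace E G] [Group G]

/-- The group multiplication in the chart at `1`. -/
noncomputable def chartMul (E G : Type*) [NormedAddCommGroup E] [NormedSpace ℝ E]
    [TopologicalSpace G] [ChartedSpace E G] [Group G] (p : E × E) : E :=
  extChartAt 𝓘(ℝ, E) (1 : G) ((extChartAt 𝓘(ℝ, E) (1 : G)).symm p.1 *
    (extChartAt 𝓘(ℝ, E) (1 : G)).symm p.2)

local notation "φ" => extChartAt 𝓘(ℝ, E) (1 : G)
local notation "o" => extChartAt 𝓘(ℝ, E) (1 : G) (1 : G)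

theorem chartMul_right : ∀ᶠ b in 𝓝 o, chartMul E G (o, b) = b := by
  filter_upwards [extChartAt_target_mem_nhds (I := 𝓘(ℝ, E)) (1 : G)] with b hb
  simp only [chartMul, extChartAt_to_inv, one_mul]
  exact (φ).right_inv hb

theorem chartMul_left : ∀ᶠ a in 𝓝 o, chartMul E G (a, o) = a := by
  filter_upwards [extChartAt_target_mem_nhds (I := 𝓘(ℝ, E)) (1 : G)] with b hb
  simp only [chartMul, extChartAt_to_inv, mul_one]
  exact (φ).right_inv hb

/-- Needed for base points such as `g * 1 * g⁻¹` and `1`, which are equal but not definitionally so.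
-/
theorem tangentBundleCore_coordChange_self_apply {M : Type*} [TopologicalSpace M]
    [ChartedSpace E M] [IsManifold 𝓘(ℝ, E) 1 M] {p q : M} (h : p = q) (v : E) :
    (tangentBundleCore 𝓘(ℝ, E) M).coordChange (achart E p) (achart E q) p v = v := by
  subst h
  exact (tangentBundleCore 𝓘(ℝ, E) M).coordChange_self _ _ (mem_chart_source E p) v

/-- The Lie bracket of two vector fields in terms of their expressions `u`, `w` in a chart. -/
theorem mlieBracket_eq_of_eventuallyEq {M : Type*} [TopologicalSpace M] [ChartedSpace E M]
    [IsManifold 𝓘(ℝ, E) 1 M] {V W : (x : M) → TangentSpace 𝓘(ℝ, E) x} {x₀ : M} {u w : E → E}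
    {u' w' : E →L[ℝ] E}
    (hV : ∀ᶠ a in 𝓝 (extChartAt 𝓘(ℝ, E) x₀ x₀), (mpullbackWithin 𝓘(ℝ, E) 𝓘(ℝ, E)
      (extChartAt 𝓘(ℝ, E) x₀).symm V (range 𝓘(ℝ, E)) a : E) = u a)
    (hW : ∀ᶠ a in 𝓝 (extChartAt 𝓘(ℝ, E) x₀ x₀), (mpullbackWithin 𝓘(ℝ, E) 𝓘(ℝ, E)
      (extChartAt 𝓘(ℝ, E) x₀).symm W (range 𝓘(ℝ, E)) a : E) = w a)
    (hu : HasFDerivAt u u' (extChartAt 𝓘(ℝ, E) x₀ x₀))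
    (hw : HasFDerivAt w w' (extChartAt 𝓘(ℝ, E) x₀ x₀)) :
    (mlieBracket 𝓘(ℝ, E) V W x₀ : E) =
      w' (u (extChartAt 𝓘(ℝ, E) x₀ x₀)) - u' (w (extChartAt 𝓘(ℝ, E) x₀ x₀)) := by
  -- The bracket is pulled back through the derivative of the chart at its own centre, which is the
  -- identity.
  have hinv : ∀ v : E, (mfderiv 𝓘(ℝ, E) 𝓘(ℝ, E) (extChartAt 𝓘(ℝ, E) x₀) x₀ :
      E →L[ℝ] E).inverse v = v := fun v =>
    (congrArg (fun T : E →L[ℝ] E => T.inverse v) mfderiv_extChartAt_self).trans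
      (congrArg (fun T : E →L[ℝ] E => T v) ContinuousLinearMap.inverse_id)
  have key : ∀ (P Q : E → E) (s : Set E), s = univ →
      P =ᶠ[𝓝 (extChartAt 𝓘(ℝ, E) x₀ x₀)] u → Q =ᶠ[𝓝 (extChartAt 𝓘(ℝ, E) x₀ x₀)] w →
      lieBracketWithin ℝ P Q s (extChartAt 𝓘(ℝ, E) x₀ x₀) =
        w' (u (extChartAt 𝓘(ℝ, E) x₀ x₀)) - u' (w (extChartAt 𝓘(ℝ, E) x₀ x₀)) := by
    rintro P Q s rfl hP hQ
    rw [lieBracketWithin_univ, lieBracket, hP.fderiv_eq, hQ.fderiv_eq, hu.fderiv, hw.fderiv,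
      hP.eq_of_nhds, hQ.eq_of_nhds]
  exact (hinv _).trans (key _ _ _ (by simp) hV hW)

section

variable [LieGroup 𝓘(ℝ, E) ∞ G]

theorem contMDiff_conj :
    ContMDiff (𝓘(ℝ, E).prod 𝓘(ℝ, E)) 𝓘(ℝ, E) ∞ (fun p : G × G => p.1 * p.2 * p.1⁻¹) :=
  (contMDiff_fst.mul contMDiff_snd).mul contMDiff_fst.inv

theorem mdifferentiableAt_conj (g x : G) :
    MDifferentiableAt 𝓘(ℝ, E) 𝓘(ℝ, E) (fun x : G => g * x * g⁻¹) x :=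
  ((contMDiff_const.mul contMDiff_id).mul contMDiff_const :
    ContMDiff 𝓘(ℝ, E) 𝓘(ℝ, E) ∞ (fun x : G => g * x * g⁻¹)).mdifferentiableAt (by simp)

theorem hasMFDerivAt_conj (g : G) :
    HasMFDerivAt 𝓘(ℝ, E) 𝓘(ℝ, E) (fun x : G => g * x * g⁻¹) (1 : G) (Ad (E := E) g) :=
  (mdifferentiableAt_conj g 1).hasMFDerivAt

theorem Ad_one (X : LieAlg E G) : Ad (1 : G) X = X := by
  have h := hasMFDerivAt_conj (E := E) (1 : G)
  have h1 : (fun x : G => (1 : G) * x * 1⁻¹) = id := by ext x; simp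
  rw [h1] at h
  exact hasMFDerivAt_unique_apply h (hasMFDerivAt_id (1 : G)) X

theorem Ad_mul (g h : G) (X : LieAlg E G) : Ad (g * h) X = Ad g (Ad h X) := by
  have h1 : (fun x : G => (g * h) * x * (g * h)⁻¹) =
      (fun x : G => g * x * g⁻¹) ∘ (fun x : G => h * x * h⁻¹) := by
    ext x; simp [mul_assoc]
  have h2 := hasMFDerivAt_comp_of_eq (hasMFDerivAt_conj (E := E) g)
    (hasMFDerivAt_conj (E := E) h) (by simp)
  rw [← h1] at h2
  exact hasMFDerivAt_unique_apply (hasMFDerivAt_conj _) h2 X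

theorem Ad_inv_Ad (g : G) (X : LieAlg E G) : Ad g⁻¹ (Ad g X) = X := by
  rw [← Ad_mul, inv_mul_cancel, Ad_one]

theorem Ad_Ad_inv (g : G) (X : LieAlg E G) : Ad g (Ad g⁻¹ X) = X := by
  rw [← Ad_mul, mul_inv_cancel, Ad_one]

/-- The adjoint representation is smooth. -/
theorem contMDiff_Ad :
    ContMDiff 𝓘(ℝ, E) 𝓘(ℝ, E →L[ℝ] E) ∞ (fun g : G => (Ad g : LieAlg E G →L[ℝ] LieAlg E G)) := by
  intro g₀
  have h := ContMDiffAt.mfderiv (I := 𝓘(ℝ, E)) (I' := 𝓘(ℝ, E)) (m := ∞) (n := ∞) (x₀ := g₀)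
    (fun g x : G => g * x * g⁻¹) (fun _ => (1 : G)) contMDiff_conj.contMDiffAt
    contMDiffAt_const (by simp)
  refine h.congr_of_eventuallyEq (Eventually.of_forall fun g => ?_)
  -- Conjugation fixes `1`, so both tangent coordinate changes in the parametrised derivative are
  -- trivial.
  have hsource : ∀ g h : G, g * 1 * g⁻¹ ∈ (chartAt E (h * 1 * h⁻¹)).source := fun g h => by
    simp
  refine Eq.symm ((inTangentCoordinates_eq (fun _ : G => (1 : G)) (fun g : G => g * 1 * g⁻¹)
    (fun g : G => (Ad g : E →L[ℝ] E)) (mem_chart_source E _) (hsource _ _)).trans ?_)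
  ext X
  exact (tangentBundleCore_coordChange_self_apply (by simp) _).trans
    (congrArg (Ad g) (tangentBundleCore_coordChange_self_apply rfl X))

theorem contMDiff_Ad_apply (X : LieAlg E G) :
    ContMDiff 𝓘(ℝ, E) 𝓘(ℝ, E) ∞ (fun g : G => Ad g X) :=
  contMDiff_Ad.clm_apply contMDiff_const

theorem hasMFDerivAt_mul_left (g x : G) :
    HasMFDerivAt 𝓘(ℝ, E) 𝓘(ℝ, E) (fun x : G => g * x) x
      (mfderiv 𝓘(ℝ, E) 𝓘(ℝ, E) (fun x : G => g * x) x) :=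
  (contMDiff_mul_left.mdifferentiable (n := ∞) (by simp) x).hasMFDerivAt

theorem hasMFDerivAt_mul_right (g x : G) :
    HasMFDerivAt 𝓘(ℝ, E) 𝓘(ℝ, E) (fun x : G => x * g) x
      (mfderiv 𝓘(ℝ, E) 𝓘(ℝ, E) (fun x : G => x * g) x) :=
  (contMDiff_mul_right.mdifferentiable (n := ∞) (by simp) x).hasMFDerivAt

theorem contDiffAt_chartMul : ContDiffAt ℝ ∞ (chartMul E G) (o, o) := by
  rw [← contMDiffAt_iff_contDiffAt]
  have hs : ContMDiffAt 𝓘(ℝ, E) 𝓘(ℝ, E) ∞ (φ).symm o :=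
    (contMDiffOn_extChartAt_symm (1 : G)).contMDiffAt (extChartAt_target_mem_nhds (1 : G))
  have h1 : ContMDiffAt 𝓘(ℝ, E × E) 𝓘(ℝ, E) ∞ (fun p : E × E => (φ).symm p.1) (o, o) :=
    ContMDiffAt.comp (o, o) (g := (φ).symm) hs contDiffAt_fst.contMDiffAt
  have h2 : ContMDiffAt 𝓘(ℝ, E × E) 𝓘(ℝ, E) ∞ (fun p : E × E => (φ).symm p.2) (o, o) :=
    ContMDiffAt.comp (o, o) (g := (φ).symm) hs contDiffAt_snd.contMDiffAt
  exact ContMDiffAt.comp_of_eq (y := (1 : G)) (g := φ) contMDiffAt_extChartAt (h1.mul h2) (by simp)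

theorem hasMFDerivAt_extChartAt_one_symm :
    HasMFDerivAt 𝓘(ℝ, E) 𝓘(ℝ, E) (φ).symm o (ContinuousLinearMap.id ℝ E) := by
  have : IsManifold 𝓘(ℝ, E) 1 G := .of_le (n := ∞) (by simp)
  have h := (mdifferentiableWithinAt_extChartAt_symm (I := 𝓘(ℝ, E))
    (mem_extChartAt_target (I := 𝓘(ℝ, E)) (1 : G))).hasMFDerivWithinAt
  rw [mfderivWithin_range_extChartAt_symm] at h
  simp only [modelWithCornersSelf_coe, range_id] at h
  exact hasMFDerivWithinAt_univ.1 h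

theorem hasMFDerivAt_extChartAt_one {y : G} (hy : y ∈ (φ).source) :
    HasMFDerivAt 𝓘(ℝ, E) 𝓘(ℝ, E) φ y (mfderiv 𝓘(ℝ, E) 𝓘(ℝ, E) φ y) := by
  have : IsManifold 𝓘(ℝ, E) 1 G := .of_le (n := ∞) (by simp)
  rw [extChartAt_source] at hy
  exact (mdifferentiableAt_extChartAt hy).hasMFDerivAt

theorem hasFDerivAt_chartMul_snd {a : E} (ha : a ∈ (φ).target) :
    HasFDerivAt (fun b => chartMul E G (a, b))
      ((mfderiv 𝓘(ℝ, E) 𝓘(ℝ, E) φ ((φ).symm a) : E →L[ℝ] E).comp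
        (mfderiv 𝓘(ℝ, E) 𝓘(ℝ, E) (fun x : G => (φ).symm a * x) 1 : E →L[ℝ] E)) o := by
  have h1 := hasMFDerivAt_comp_of_eq (hasMFDerivAt_mul_left (E := E) ((φ).symm a) 1)
    (hasMFDerivAt_extChartAt_one_symm (E := E)) (extChartAt_to_inv (1 : G))
  have h2 := hasMFDerivAt_comp_of_eq (hasMFDerivAt_extChartAt_one ((φ).map_target ha)) h1
    (by simp)
  exact h2.hasFDerivAt

theorem hasFDerivAt_chartMul_fst {a : E} (ha : a ∈ (φ).target) :
    HasFDerivAt (fun b => chartMul E G (b, a))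
      ((mfderiv 𝓘(ℝ, E) 𝓘(ℝ, E) φ ((φ).symm a) : E →L[ℝ] E).comp
        (mfderiv 𝓘(ℝ, E) 𝓘(ℝ, E) (fun x : G => x * (φ).symm a) 1 : E →L[ℝ] E)) o := by
  have h1 := hasMFDerivAt_comp_of_eq (hasMFDerivAt_mul_right (E := E) ((φ).symm a) 1)
    (hasMFDerivAt_extChartAt_one_symm (E := E)) (extChartAt_to_inv (1 : G))
  have h2 := hasMFDerivAt_comp_of_eq (hasMFDerivAt_extChartAt_one ((φ).map_target ha)) h1
    (by simp)
  exact h2.hasFDerivAt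

theorem eventually_differentiableAt_chartMul :
    ∀ᶠ p in 𝓝 (o, o), DifferentiableAt ℝ (chartMul E G) p := by
  have h : ContDiffAt ℝ 1 (chartMul E G) (o, o) := contDiffAt_chartMul.of_le (by simp)
  filter_upwards [h.eventually (by simp)] with p hp using hp.differentiableAt (by simp)

theorem fderiv_chartMul_snd (Y : E) :
    ∀ᶠ a in 𝓝 o, fderiv ℝ (chartMul E G) (a, o) (0, Y) =
      (mfderiv 𝓘(ℝ, E) 𝓘(ℝ, E) φ ((φ).symm a) : E →L[ℝ] E)
        ((mfderiv 𝓘(ℝ, E) 𝓘(ℝ, E) (fun x : G => (φ).symm a * x) 1 : E →L[ℝ] E) Y) := by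
  have hc : ContinuousAt (fun a : E => (a, o)) o := by fun_prop
  filter_upwards [hc.eventually eventually_differentiableAt_chartMul,
    extChartAt_target_mem_nhds (I := 𝓘(ℝ, E)) (1 : G)] with a hd ha
  have h1 := hd.hasFDerivAt.comp o (hasFDerivAt_prodMk_right a o)
  exact congrArg (fun T : E →L[ℝ] E => T Y) (h1.unique (hasFDerivAt_chartMul_snd ha))

/-- The quantifier over `Y` sits inside the eventuality because `Y` will be replaced by `Ad a Y`,
which varies with `a`. -/
theorem fderiv_chartMul_fst :
    ∀ᶠ a in 𝓝 o, ∀ Y : E, fderiv ℝ (chartMul E G) (o, a) (Y, 0) =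
      (mfderiv 𝓘(ℝ, E) 𝓘(ℝ, E) φ ((φ).symm a) : E →L[ℝ] E)
        ((mfderiv 𝓘(ℝ, E) 𝓘(ℝ, E) (fun x : G => x * (φ).symm a) 1 : E →L[ℝ] E) Y) := by
  have hc : ContinuousAt (fun a : E => (o, a)) o := by fun_prop
  filter_upwards [hc.eventually eventually_differentiableAt_chartMul,
    extChartAt_target_mem_nhds (I := 𝓘(ℝ, E)) (1 : G)] with a hd ha Y
  have h1 := HasFDerivAt.comp (f := fun b : E => (b, a)) o hd.hasFDerivAt
    (hasFDerivAt_prodMk_left (𝕜 := ℝ) o a)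
  exact congrArg (fun T : E →L[ℝ] E => T Y) (h1.unique (hasFDerivAt_chartMul_fst ha))

/-- Left and right translations differ by the adjoint action. -/
theorem mfderiv_mul_left_eq (g : G) (Y : E) :
    (mfderiv 𝓘(ℝ, E) 𝓘(ℝ, E) (fun x : G => g * x) 1 : E →L[ℝ] E) Y =
      (mfderiv 𝓘(ℝ, E) 𝓘(ℝ, E) (fun x : G => x * g) 1 : E →L[ℝ] E)
        (Ad (E := E) g Y) := by
  have h1 : (fun x : G => g * x) = (fun x : G => x * g) ∘ (fun x : G => g * x * g⁻¹) := by
    ext x; simp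
  have h2 := hasMFDerivAt_comp_of_eq (hasMFDerivAt_mul_right (E := E) g 1)
    (hasMFDerivAt_conj g) (by simp)
  rw [← h1] at h2
  exact hasMFDerivAt_unique_apply (hasMFDerivAt_mul_left g 1) h2 Y

/-- The local expression of a left-invariant vector field. -/
theorem mpullbackWithin_mulInvariantVectorField (Y : E) :
    ∀ᶠ a in 𝓝 o, (mpullbackWithin 𝓘(ℝ, E) 𝓘(ℝ, E) (φ).symm
      (mulInvariantVectorField (show GroupLieAlgebra 𝓘(ℝ, E) G from Y)) (range 𝓘(ℝ, E)) a : E) =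
      fderiv ℝ (chartMul E G) (a, o) (0, Y) := by
  have : IsManifold 𝓘(ℝ, E) 1 G := .of_le (n := ∞) (by simp)
  filter_upwards [fderiv_chartMul_snd (G := G) Y,
    extChartAt_target_mem_nhds (I := 𝓘(ℝ, E)) (1 : G)] with a h ha
  rw [h, mpullbackWithin_apply, ContinuousLinearMap.inverse_eq
    (mfderivWithin_extChartAt_symm_comp_mfderiv_extChartAt ha)
    (mfderiv_extChartAt_comp_mfderivWithin_extChartAt_symm ha)]
  rfl

/-- This is `dL_g = dR_g ∘ Ad g` in the chart. Differentiating it in `a` relates the derivative of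
`Ad` to the second derivative of the multiplication. -/
theorem fderiv_chartMul_snd_eq_fst (Y : E) :
    ∀ᶠ a in 𝓝 o, fderiv ℝ (chartMul E G) (a, o) (0, Y) =
      fderiv ℝ (chartMul E G) (o, a) (Ad (E := E) ((φ).symm a) Y, 0) := by
  filter_upwards [fderiv_chartMul_snd (G := G) Y, fderiv_chartMul_fst (E := E) (G := G)]
    with a h1 h2
  rw [h1, h2, mfderiv_mul_left_eq]

/-- The differential of the adjoint representation is the Lie bracket. -/
theorem hasMFDerivAt_Ad_apply (Y : LieAlg E G) :
    ∃ A : E →L[ℝ] E, HasMFDerivAt 𝓘(ℝ, E) 𝓘(ℝ, E) (fun g : G => Ad g Y) 1 A ∧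
      ∀ X, A X = lieBr G X Y := by
  refine ⟨mfderiv 𝓘(ℝ, E) 𝓘(ℝ, E) (fun g : G => Ad g Y) 1,
    ((contMDiff_Ad_apply Y).mdifferentiable (by simp) 1).hasMFDerivAt, fun X => ?_⟩
  have hA := hasMFDerivAt_comp_of_eq
    ((contMDiff_Ad_apply (G := G) Y).mdifferentiable (by simp) 1).hasMFDerivAt
    hasMFDerivAt_extChartAt_one_symm (extChartAt_to_inv (1 : G))
  replace hA := hA.hasFDerivAt
  set A : E →L[ℝ] E := mfderiv 𝓘(ℝ, E) 𝓘(ℝ, E) (fun g : G => Ad g Y) 1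
  set f := chartMul E G
  have hD : HasFDerivAt (fderiv ℝ f) (fderiv ℝ (fderiv ℝ f) (o, o)) (o, o) :=
    ((contDiffAt_chartMul (E := E) (G := G)).fderiv_right (m := ∞) (by simp)).differentiableAt
      (by simp) |>.hasFDerivAt
  set D := fderiv ℝ (fderiv ℝ f) (o, o)
  have hsymm : ∀ v w, D v w = D w v :=
    (contDiffAt_chartMul (E := E) (G := G)).isSymmSndFDerivAt (by
      rw [minSmoothness_of_isRCLikeNormedField]; exact WithTop.coe_le_coe.2 le_top)
  have hu : ∀ Z : E, HasFDerivAt (fun a => fderiv ℝ f (a, o) (0, Z))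
      ((ContinuousLinearMap.apply ℝ E ((0 : E), Z)).comp (D.comp (.inl ℝ E E))) o := fun Z => by
    have := HasFDerivAt.comp (f := fun a : E => (a, o)) o hD (hasFDerivAt_prodMk_left (𝕜 := ℝ) o o)
    exact (ContinuousLinearMap.apply ℝ E ((0 : E), Z)).hasFDerivAt.comp o this
  have hf0 : ∀ v : E, fderiv ℝ f (o, o) (v, 0) = v := fun v => by
    have h1 := HasFDerivAt.comp (f := fun a : E => (a, o)) o
      (((contDiffAt_chartMul (E := E) (G := G)).differentiableAt (by simp)).hasFDerivAt)
      (hasFDerivAt_prodMk_left (𝕜 := ℝ) o o)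
    have h2 := (hasFDerivAt_id (𝕜 := ℝ) o).congr_of_eventuallyEq (chartMul_left (E := E) (G := G))
    exact congrArg (fun T : E →L[ℝ] E => T v) (h1.unique h2)
  -- Differentiate `fderiv_chartMul_snd_eq_fst` at `o` along `X`; the term `A X` comes from the
  -- varying argument `Ad a Y`.
  have hY : D (X, 0) (0, Y) = D (0, X) (Y, 0) + A X := by
    have h1 := HasFDerivAt.comp (f := fun a : E => (o, a)) o hD (hasFDerivAt_prodMk_right (𝕜 := ℝ) o o)
    have h2 := h1.clm_apply (hA.prodMk (hasFDerivAt_const (0 : E) o))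
    have h3 := (hu Y).unique (h2.congr_of_eventuallyEq (fderiv_chartMul_snd_eq_fst (G := G) Y))
    have h4 : D (X, 0) (0, Y) = fderiv ℝ f (o, o) (A X, 0) +
      D (0, X) (Ad (E := E) ((φ).symm o) Y, 0) := congrArg (fun T : E →L[ℝ] E => T X) h3
    rw [h4, hf0, extChartAt_to_inv, Ad_one, add_comm]
  -- In the chart the left-invariant fields are `a ↦ ∂₂f(a, o)X` and `a ↦ ∂₂f(a, o)Y`, with values
  -- `X` and `Y` at `o`.
  have hbr : lieBr G X Y = D (X, 0) (0, Y) - D (Y, 0) (0, X) := by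
    have hX := mpullbackWithin_mulInvariantVectorField (G := G) X
    have hY := mpullbackWithin_mulInvariantVectorField (G := G) Y
    have h0 : ∀ Z : E, fderiv ℝ f (o, o) (0, Z) = Z := fun Z => by
      have h1 := HasFDerivAt.comp (f := fun a : E => (o, a)) o
        (((contDiffAt_chartMul (E := E) (G := G)).differentiableAt (by simp)).hasFDerivAt)
        (hasFDerivAt_prodMk_right (𝕜 := ℝ) o o)
      have h2 := (hasFDerivAt_id (𝕜 := ℝ) o).congr_of_eventuallyEq
        (chartMul_right (E := E) (G := G))
      exact congrArg (fun T : E →L[ℝ] E => T Z) (h1.unique h2)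
    refine (mlieBracket_eq_of_eventuallyEq hX hY (hu X) (hu Y)).trans ?_
    rw [h0, h0]
    rfl
  -- By symmetry of the second derivative the two remaining second-order terms cancel, leaving `A
  -- X`.
  rw [hbr, hY, hsymm (Y, 0)]
  abel

end
end Adjoint

/-! ### Infinitesimal adjoint action and invariance of the form -/

section AdjointCurves

open Filter Topology VectorField

variable {E : Type*} [NormedAddCommGroup E] [NormedSpace ℝ E]
theorem hasDerivAt_of_hasMFDerivAt {E' : Type*} [NormedAddCommGroup E'] [NormedSpace ℝ E']
    {M : Type*} [TopologicalSpace M]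
    [ChartedSpace E M] {f : M → E'} {f' : E →L[ℝ] E'} {c : ℝ → M} {t : ℝ} {g : M} {X : E}
    (hf : HasMFDerivAt 𝓘(ℝ, E) 𝓘(ℝ, E') f g f')
    (hc : HasMFDerivAt 𝓘(ℝ, ℝ) 𝓘(ℝ, E) c t ((1 : ℝ →L[ℝ] ℝ).smulRight X)) (h : c t = g) :
    HasDerivAt (fun s => f (c s)) (f' X) t := by
  have h1 : HasFDerivAt (f ∘ c) (f'.comp ((1 : ℝ →L[ℝ] ℝ).smulRight X)) t :=
    (hasMFDerivAt_comp_of_eq hf hc h).hasFDerivAt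
  have h2 : (f'.comp ((1 : ℝ →L[ℝ] ℝ).smulRight X)) 1 = f' X :=
    congrArg f' (one_smul ℝ X)
  rw [← h2]
  exact h1.hasDerivAt

variable {G : Type*} [TopologicalSpace G] [ChartedSpace E G] [Group G]

theorem lieBr_swap (X Y : LieAlg E G) : lieBr G X Y = -lieBr G Y X :=
  mlieBracket_swap_apply

variable [LieGroup 𝓘(ℝ, E) ∞ G]

/-- Only the velocity at `0` matters below, so a straight line in the chart replaces the
exponential. -/
theorem exists_hasMFDerivAt_one (X : E) : ∃ c : ℝ → G, c 0 = 1 ∧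
    HasMFDerivAt 𝓘(ℝ, ℝ) 𝓘(ℝ, E) c 0 ((1 : ℝ →L[ℝ] ℝ).smulRight X) := by
  let b : ℝ → E := fun s => extChartAt 𝓘(ℝ, E) (1 : G) 1 + s • X
  have hb : HasDerivAt b X 0 := by
    have := ((hasDerivAt_id (0 : ℝ)).smul_const X).const_add (extChartAt 𝓘(ℝ, E) (1 : G) 1)
    rwa [one_smul] at this
  have hb0 : b 0 = extChartAt 𝓘(ℝ, E) (1 : G) 1 := by simp [b]
  refine ⟨fun s => (extChartAt 𝓘(ℝ, E) (1 : G)).symm (b s), ?_, ?_⟩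
  · simp only [hb0, extChartAt_to_inv]
  · exact hasMFDerivAt_comp_of_eq hasMFDerivAt_extChartAt_one_symm
      hb.hasFDerivAt.hasMFDerivAt hb0

/-- The derivative of the adjoint action along a curve through `1`. -/
theorem hasDerivAt_Ad {c : ℝ → G} {t : ℝ} {X : E}
    (hc : HasMFDerivAt 𝓘(ℝ, ℝ) 𝓘(ℝ, E) c t ((1 : ℝ →L[ℝ] ℝ).smulRight X)) (h : c t = 1)
    (Y : LieAlg E G) : HasDerivAt (fun s => Ad (c s) Y) (lieBr G X Y) t := by
  obtain ⟨A, hA, hAX⟩ := hasMFDerivAt_Ad_apply Y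
  rw [← hAX]
  exact hasDerivAt_of_hasMFDerivAt hA hc h

/-- Linearity in `X` is inherited from the differential of `g ↦ Ad g Y`. -/
theorem lieBr_add_left (X X' Y : LieAlg E G) :
    lieBr G (X + X') Y = lieBr G X Y + lieBr G X' Y := by
  obtain ⟨A, -, hA⟩ := hasMFDerivAt_Ad_apply Y
  simp only [← hA, map_add]

theorem lieBr_smul_left (r : ℝ) (X Y : LieAlg E G) : lieBr G (r • X) Y = r • lieBr G X Y := by
  obtain ⟨A, -, hA⟩ := hasMFDerivAt_Ad_apply Y
  simp only [← hA, map_smul]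

variable (E G) in
/-- The Lie bracket as a bilinear map. -/
noncomputable def lieBrBilin : LieAlg E G →ₗ[ℝ] LieAlg E G →ₗ[ℝ] LieAlg E G :=
  LinearMap.mk₂ ℝ (lieBr G) lieBr_add_left lieBr_smul_left
    (fun X Y Y' => by
      rw [lieBr_swap, lieBr_add_left, neg_add, ← lieBr_swap, ← lieBr_swap])
    (fun r X Y => by
      rw [lieBr_swap, lieBr_smul_left, ← smul_neg, ← lieBr_swap])

@[simp]
theorem lieBrBilin_apply (X Y : LieAlg E G) : lieBrBilin E G X Y = lieBr G X Y := rfl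

theorem lieBr_neg_left (X Y : LieAlg E G) : lieBr G (-X) Y = -lieBr G X Y := by
  rw [← lieBrBilin_apply, map_neg, LinearMap.neg_apply, lieBrBilin_apply]

theorem lieBr_sub_right (X Y Y' : LieAlg E G) : lieBr G X (Y - Y') = lieBr G X Y - lieBr G X Y' := by
  rw [← lieBrBilin_apply, map_sub, lieBrBilin_apply, lieBrBilin_apply]

/-- The derivative of the inverse of the adjoint action along a curve through `1`. -/
theorem hasDerivAt_Ad_inv {c : ℝ → G} {t : ℝ} {X : E}
    (hc : HasMFDerivAt 𝓘(ℝ, ℝ) 𝓘(ℝ, E) c t ((1 : ℝ →L[ℝ] ℝ).smulRight X)) (h : c t = 1)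
    (Y : LieAlg E G) : HasDerivAt (fun s => Ad (c s)⁻¹ Y) (-lieBr G X Y) t := by
  have hinv : ContMDiff 𝓘(ℝ, E) 𝓘(ℝ, E) ∞ (fun g : G => Ad g⁻¹ Y) :=
    (contMDiff_Ad_apply Y).comp contMDiff_id.inv
  have hW := hasDerivAt_of_hasMFDerivAt (hinv.mdifferentiable (by simp) 1).hasMFDerivAt hc h
  have hN := hasDerivAt_of_hasMFDerivAt
    ((contMDiff_Ad (E := E) (G := G)).mdifferentiable (by simp) 1).hasMFDerivAt hc h
  have hNY := (hN.clm_apply (hasDerivAt_const t Y)).unique (hasDerivAt_Ad hc h Y)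
  -- Product rule for the constant curve `Ad (c s) (Ad (c s)⁻¹ Y) = Y`.
  have h0 := (hN.clm_apply hW).unique ((hasDerivAt_const t Y).congr_of_eventuallyEq
    (Eventually.of_forall fun s => Ad_Ad_inv (c s) Y))
  rw [h, inv_one, Ad_one, Ad_one] at h0
  rw [map_zero, add_zero] at hNY
  rw [hNY] at h0
  rwa [eq_neg_of_add_eq_zero_right h0] at hW

/-- The infinitesimal form of the invariance of an inner product. -/
theorem AdInvariantInner.form_lieBr_left (B : AdInvariantInner E G) [FiniteDimensional ℝ E]
    (X Y Z : LieAlg E G) : B.form (lieBr G X Y) Z = -B.form Y (lieBr G X Z) := by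
  obtain ⟨c, hc0, hc⟩ := exists_hasMFDerivAt_one (G := G) X
  let b : E →L[ℝ] E →L[ℝ] ℝ :=
    LinearMap.toContinuousLinearMap (LinearMap.toContinuousLinearMap.toLinearMap ∘ₗ B.form)
  have h1 : HasDerivAt (fun s => b (Ad (c s) Y) (Ad (c s) Z))
      (b (lieBr G X Y) (Ad (c 0) Z) + b (Ad (c 0) Y) (lieBr G X Z)) 0 :=
    (b.hasFDerivAt.comp_hasDerivAt (0 : ℝ) (hasDerivAt_Ad hc hc0 Y)).clm_apply
      (hasDerivAt_Ad hc hc0 Z)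
  have h2 : HasDerivAt (fun s => b (Ad (c s) Y) (Ad (c s) Z)) 0 0 :=
    (hasDerivAt_const (0 : ℝ) (B.form Y Z)).congr_of_eventuallyEq
      (Eventually.of_forall fun s => B.invariant (c s) Y Z)
  have h3 := h1.unique h2
  rw [hc0, Ad_one, Ad_one] at h3
  exact eq_neg_of_add_eq_zero_left h3

end AdjointCurves

/-! ### The Lie algebra of the subgroup -/

section LieSubgroup

open Filter Topology

variable {E : Type*} [NormedAddCommGroup E] [NormedSpace ℝ E]
variable {G : Type*} [TopologicalSpace G] [ChartedSpace E G] [Group G]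
variable {EK : Type*} [NormedAddCommGroup EK] [NormedSpace ℝ EK]
variable {K : Subgroup G} [ChartedSpace EK K]

theorem IsLieSubgroup.hasMFDerivAt_val (hK : IsLieSubgroup (E := E) (EK := EK) K) :
    HasMFDerivAt 𝓘(ℝ, EK) 𝓘(ℝ, E) (Subtype.val : K → G) 1 (lieIncl (E := E) (EK := EK) K) :=
  (hK.contMDiff_val.mdifferentiable (by simp) 1).hasMFDerivAt

theorem IsLieSubgroup.lieIncl_injective (hK : IsLieSubgroup (E := E) (EK := EK) K) :
    Function.Injective (lieIncl (E := E) (EK := EK) K) :=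
  hK.mfderiv_injective 1

theorem IsLieSubgroup.hasMFDerivAt_coe (hK : IsLieSubgroup (E := E) (EK := EK) K) {c : ℝ → K}
    {t : ℝ} {X : EK} (hc : HasMFDerivAt 𝓘(ℝ, ℝ) 𝓘(ℝ, EK) c t ((1 : ℝ →L[ℝ] ℝ).smulRight X))
    (h : c t = 1) : HasMFDerivAt 𝓘(ℝ, ℝ) 𝓘(ℝ, E) (fun s => (c s : G)) t
      ((1 : ℝ →L[ℝ] ℝ).smulRight (lieIncl (E := E) (EK := EK) K X)) := by
  have h1 := hasMFDerivAt_comp_of_eq (f' := (1 : ℝ →L[ℝ] ℝ).smulRight X) hK.hasMFDerivAt_val hc h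
  have h2 : (lieIncl (E := E) (EK := EK) K).comp ((1 : ℝ →L[ℝ] ℝ).smulRight X) =
      (1 : ℝ →L[ℝ] ℝ).smulRight (lieIncl (E := E) (EK := EK) K X) :=
    ContinuousLinearMap.ext fun r => map_smul (lieIncl (E := E) (EK := EK) K) r X
  exact h2 ▸ h1

variable [LieGroup 𝓘(ℝ, E) ∞ G] [LieGroup 𝓘(ℝ, EK) ∞ K]

/-- The inclusion commutes with conjugation by `k`; differentiate at `1`. -/
theorem IsLieSubgroup.lieIncl_Ad (hK : IsLieSubgroup (E := E) (EK := EK) K) (k : K)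
    (X : LieAlg EK K) :
    lieIncl (E := E) K (Ad k X) = Ad (k : G) (lieIncl (E := E) K X) := by
  have h1 := hasMFDerivAt_comp_of_eq hK.hasMFDerivAt_val (hasMFDerivAt_conj (E := EK) k) (by simp)
  have h2 := hasMFDerivAt_comp_of_eq (hasMFDerivAt_conj (E := E) (k : G)) hK.hasMFDerivAt_val rfl
  exact hasMFDerivAt_unique_apply h1 h2 X

/-- The inclusion of Lie algebras is a homomorphism. -/
theorem IsLieSubgroup.lieIncl_lieBr (hK : IsLieSubgroup (E := E) (EK := EK) K)
    (X Y : LieAlg EK K) : lieIncl (E := E) K (lieBr K X Y) =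
      lieBr G (lieIncl (E := E) K X) (lieIncl (E := E) K Y) := by
  obtain ⟨c, hc0, hc⟩ := exists_hasMFDerivAt_one (G := K) X
  have h1 := (lieIncl (E := E) (EK := EK) K).hasFDerivAt.comp_hasDerivAt (0 : ℝ)
    (hasDerivAt_Ad hc hc0 Y)
  have h2 := hasDerivAt_Ad (hK.hasMFDerivAt_coe hc hc0) (by simp [hc0]) (lieIncl (E := E) K Y)
  refine h1.unique (h2.congr_of_eventuallyEq (Eventually.of_forall fun s => ?_))
  exact hK.lieIncl_Ad (c s) Y

end LieSubgroup

section RieszLinear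

variable {V : Type*} [AddCommGroup V] [Module ℝ V] [FiniteDimensional ℝ V]

/-- The Riesz isomorphism of a positive definite form as a linear map. -/
noncomputable def rieszLinear (b : V →ₗ[ℝ] V →ₗ[ℝ] ℝ) (hb : ∀ X, X ≠ 0 → 0 < b X X) :
    (V →ₗ[ℝ] ℝ) →ₗ[ℝ] V where
  toFun := riesz b
  map_add' φ ψ := riesz_unique b hb _ _ fun w => by simp [riesz_spec b hb]
  map_smul' r φ := riesz_unique b hb _ _ fun w => by simp [riesz_spec b hb]

theorem eq_of_forall_form_eq {b : V →ₗ[ℝ] V →ₗ[ℝ] ℝ} (hb : ∀ X, X ≠ 0 → 0 < b X X) {v w : V}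
    (h : ∀ X, b v X = b w X) : v = w :=
  (riesz_unique b hb (b w) v h).symm.trans (riesz_unique b hb (b w) w fun _ => rfl)

end RieszLinear

/-! ### Moment map and Hamiltonian vector fields -/

section Hamiltonian

open Filter Topology

variable {E : Type*} [NormedAddCommGroup E] [NormedSpace ℝ E]
variable {G : Type*} [TopologicalSpace G] [ChartedSpace E G] [Group G]
variable {EK : Type*} [NormedAddCommGroup EK] [NormedSpace ℝ EK]
variable {K : Subgroup G} [ChartedSpace EK K]

section Form

variable (B : AdInvariantInner E G) (hK : IsLieSubgroup (E := E) (EK := EK) K)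

theorem subForm_apply (X Y : LieAlg EK K) :
    subForm B K X Y = B.form (lieIncl (E := E) K X) (lieIncl (E := E) K Y) := rfl

include hK in
theorem subForm_pos (X : LieAlg EK K) (hX : X ≠ 0) : 0 < subForm B K X X :=
  B.pos _ fun h => hX (hK.lieIncl_injective (h.trans (map_zero _).symm))

variable [FiniteDimensional ℝ EK]

include hK in
theorem subForm_momentMap (Z : LieAlg E G) (Y : LieAlg EK K) :
    subForm B K (momentMap B K Z) Y = B.form Z (lieIncl (E := E) K Y) :=
  riesz_spec _ (subForm_pos B hK) _ _

include hK in
theorem subForm_lieGrad (F : LieAlg EK K → ℝ) (X Y : LieAlg EK K) :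
    subForm B K (lieGrad B K F X) Y = fderiv ℝ F X Y :=
  riesz_spec _ (subForm_pos B hK) _ _

-- The gradient is `fderiv ℝ F` followed by a fixed linear map, the Riesz isomorphism.
include hK in
theorem contDiff_lieGrad {F : EK → ℝ} (hF : ContDiff ℝ ∞ F) :
    ContDiff ℝ ∞ (lieGrad B K F : EK → EK) := by
  let R : (EK →L[ℝ] ℝ) →L[ℝ] EK := LinearMap.toContinuousLinearMap
    (rieszLinear (subForm B K) (subForm_pos B hK) ∘ₗ ContinuousLinearMap.coeLM ℝ)
  exact R.contDiff.comp (hF.fderiv_right (m := ∞) (by simp))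

variable [FiniteDimensional ℝ E]

/-- The moment map as a continuous linear map. -/
noncomputable def momentMapL : E →L[ℝ] EK :=
  LinearMap.toContinuousLinearMap
    (rieszLinear (subForm B K) (subForm_pos B hK) ∘ₗ
      ((lieIncl (E := E) (EK := EK) K).toLinearMap.lcomp ℝ ℝ) ∘ₗ B.form)

theorem momentMapL_apply (Z : E) : momentMapL B hK Z = momentMap B K Z := rfl

include hK in
theorem hasFDerivAt_momentMap (Z : E) :
    HasFDerivAt (momentMap B K : E → EK) (momentMapL B hK) Z :=
  (momentMapL B hK).hasFDerivAt

include hK in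
theorem contDiff_momentMap : ContDiff ℝ ∞ (momentMap B K : E → EK) :=
  (momentMapL B hK).contDiff

include hK in
theorem fderiv_comp_momentMap {F : EK → ℝ} (hF : ContDiff ℝ ∞ F) (Z W : E) :
    fderiv ℝ (F ∘ momentMap B K : E → ℝ) Z W =
      B.form (lieIncl (E := E) K (lieGrad B K F (momentMap B K Z))) W := by
  have h := ((hF.differentiable (by simp) (momentMap B K Z)).hasFDerivAt.comp Z
    (hasFDerivAt_momentMap B hK Z)).fderiv
  rw [h, ContinuousLinearMap.comp_apply, momentMapL_apply, ← subForm_lieGrad B hK]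
  have hs : subForm B K (lieGrad B K F (momentMap B K Z)) (momentMap B K W) =
      subForm B K (momentMap B K W) (lieGrad B K F (momentMap B K Z)) := B.symm _ _
  rw [hs, subForm_momentMap B hK, B.symm]

end Form

variable [LieGroup 𝓘(ℝ, E) ∞ G]

/-- The moment map is equivariant for the adjoint action of the subgroup. -/
theorem momentMap_Ad [LieGroup 𝓘(ℝ, EK) ∞ K] [FiniteDimensional ℝ EK] (B : AdInvariantInner E G)
    (hK : IsLieSubgroup (E := E) (EK := EK) K) (k : K) (Z : LieAlg E G) :
    momentMap B K (Ad (k : G) Z) =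
      Ad (E := EK) k (momentMap B K Z) := by
  refine eq_of_forall_form_eq (subForm_pos B hK) fun Y => ?_
  rw [subForm_momentMap B hK, subForm_apply, hK.lieIncl_Ad, ← B.invariant (k : G)⁻¹,
    Ad_inv_Ad, ← B.invariant (k : G)⁻¹ (Ad (k : G) _), Ad_inv_Ad]
  have := hK.lieIncl_Ad k⁻¹ Y
  rw [Subgroup.coe_inv] at this
  rw [← this, ← subForm_momentMap B hK, subForm_apply]

variable [FiniteDimensional ℝ E]

/-- Skewness of `ad` shows that the value depends on the tangent vectors alone, so the chosen
representatives in `kks` may be exchanged for `X` and `Y`, one slot at a time. -/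
theorem kks_apply (B : AdInvariantInner E G) (Z X Y : LieAlg E G) :
    kks B Z (lieBr G X Z) (lieBr G Y Z) = B.form (lieBr G X Z) Y := by
  have h : lieBr G X Z ∈ orbitTangent (G := G) Z ∧ lieBr G Y Z ∈ orbitTangent (G := G) Z :=
    ⟨⟨X, rfl⟩, ⟨Y, rfl⟩⟩
  have aux : ∀ X Y : LieAlg E G, B.form (lieBr G X Z) Y = -B.form Z (lieBr G X Y) := fun X Y =>
    B.form_lieBr_left X Z Y
  rw [kks, dif_pos h, ← aux, h.1.choose_spec, aux, lieBr_swap, map_neg, neg_neg]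
  have h2 := aux h.2.choose X
  rw [h.2.choose_spec, aux] at h2
  rw [aux, lieBr_swap X Y, map_neg, neg_neg, ← neg_inj, ← h2]

/-- The Hamiltonian vector field of a collective function. -/
theorem isHamiltonianVector_iff [FiniteDimensional ℝ EK] (B : AdInvariantInner E G)
    (hK : IsLieSubgroup (E := E) (EK := EK) K) {F : LieAlg EK K → ℝ} (hF : ContDiff ℝ ∞ F)
    (Z v : LieAlg E G) : IsHamiltonianVector B (F ∘ momentMap B K) Z v ↔
      v = lieBr G (lieIncl K (lieGrad B K F (momentMap B K Z))) Z := by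
  set ξ : LieAlg E G := lieIncl K (lieGrad B K F (momentMap B K Z)) with hξ
  -- The differential along `[Y, Z]` is `(ξ, [Y, Z])`; skewness moves the bracket onto `ξ`, matching
  -- the shape of `kks_apply`.
  have hd : ∀ Y, fderiv ℝ (F ∘ momentMap B K : E → ℝ) Z (lieBr G Y Z) =
      -B.form (lieBr G ξ Z) Y := fun Y => by
    rw [fderiv_comp_momentMap B hK hF, ← hξ, lieBr_swap Y Z, map_neg, ← B.form_lieBr_left,
      lieBr_swap Z ξ, map_neg, LinearMap.neg_apply]
  constructor
  · rintro ⟨⟨X, rfl⟩, h⟩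
    refine eq_of_forall_form_eq B.pos fun Y => ?_
    have := h _ ⟨Y, rfl⟩
    rw [hd, kks_apply] at this
    linarith
  · rintro rfl
    refine ⟨⟨ξ, rfl⟩, ?_⟩
    rintro _ ⟨Y, rfl⟩
    rw [hd, kks_apply, neg_add_cancel]

variable [LieGroup 𝓘(ℝ, EK) ∞ K]

/-- Test against `Y ∈ 𝔨`: skewness upstairs and in `𝔨` turns both sides into `-(Z, [X, Y])`. -/
theorem momentMap_lieBr [FiniteDimensional ℝ EK] (B : AdInvariantInner E G)
    (hK : IsLieSubgroup (E := E) (EK := EK) K) (X : LieAlg EK K) (Z : LieAlg E G) :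
    momentMap B K (lieBr G (lieIncl K X) Z) = lieBr K X (momentMap B K Z) := by
  refine eq_of_forall_form_eq (subForm_pos B hK) fun Y => ?_
  rw [subForm_momentMap B hK, B.form_lieBr_left, ← hK.lieIncl_lieBr, ← subForm_momentMap B hK,
    subForm_apply, subForm_apply, hK.lieIncl_lieBr, hK.lieIncl_lieBr, B.form_lieBr_left]

end Hamiltonian

/-! ### Lifting the flow to the subgroup -/

section Flow

open Filter Topology

variable {E : Type*} [NormedAddCommGroup E] [NormedSpace ℝ E]
variable {G : Type*} [TopologicalSpace G] [ChartedSpace E G] [Group G]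

/-- The Lie bracket as a continuous bilinear map. -/
noncomputable def lieBrL (E G : Type*) [NormedAddCommGroup E] [NormedSpace ℝ E]
    [FiniteDimensional ℝ E] [TopologicalSpace G] [ChartedSpace E G] [Group G]
    [LieGroup 𝓘(ℝ, E) ∞ G] : E →L[ℝ] E →L[ℝ] E :=
  LinearMap.toContinuousLinearMap (LinearMap.toContinuousLinearMap.toLinearMap ∘ₗ lieBrBilin E G)

theorem ContDiff.lieBr [FiniteDimensional ℝ E] [LieGroup 𝓘(ℝ, E) ∞ G] {E' : Type*}
    [NormedAddCommGroup E'] [NormedSpace ℝ E'] {n : WithTop ℕ∞} {f g : E' → E}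
    (hf : ContDiff ℝ n f) (hg : ContDiff ℝ n g) :
    ContDiff ℝ n (fun x => (_root_.lieBr (E := E) G (f x) (g x) : E)) :=
  ((lieBrL E G).contDiff.comp hf).clm_apply hg

/-- A left-invariant vector field with smoothly varying coefficients is smooth. -/
theorem contMDiff_mulInvariantVectorField_apply [FiniteDimensional ℝ E] [LieGroup 𝓘(ℝ, E) ∞ G]
    {w : G → E} (hw : ContMDiff 𝓘(ℝ, E) 𝓘(ℝ, E) 1 w) :
    ContMDiff 𝓘(ℝ, E) 𝓘(ℝ, E).tangent 1 (fun g : G =>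
      (⟨g, mulInvariantVectorField (show GroupLieAlgebra 𝓘(ℝ, E) G from w g) g⟩ :
        TangentBundle 𝓘(ℝ, E) G)) := by
  have : LieGroup 𝓘(ℝ, E) (minSmoothness ℝ 3) G := .of_le (n := ∞) (by
    rw [minSmoothness_of_isRCLikeNormedField]; exact WithTop.coe_le_coe.2 le_top)
  -- In a basis the field is a finite sum of left-invariant fields with `C¹` coefficients.
  let b := Module.finBasis ℝ E
  have h1 : ∀ i, ContMDiff 𝓘(ℝ, E) 𝓘(ℝ, E).tangent 1 (fun g : G =>
      (⟨g, b.coord i (w g) •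
        mulInvariantVectorField (show GroupLieAlgebra 𝓘(ℝ, E) G from b i) g⟩ :
        TangentBundle 𝓘(ℝ, E) G)) := fun i => by
    refine ContMDiff.smul_section (f := fun g => b.coord i (w g)) ?_ ?_
    · exact (LinearMap.toContinuousLinearMap (b.coord i)).contMDiff.comp hw
    · refine (contMDiff_mulInvariantVectorField _).of_le ?_
      rw [minSmoothness_of_isRCLikeNormedField]
      exact one_le_two
  have h2 := ContMDiff.sum_section (s := Finset.univ) fun i _ => h1 i
  convert! h2 using 3 with g
  have h3 : w g = ∑ i, b.coord i (w g) • b i := (b.sum_repr (w g)).symm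
  have h4 : ∀ T : E →L[ℝ] E, T (w g) = ∑ i, b.coord i (w g) • T (b i) := fun T => by
    conv_lhs => rw [h3]
    simp only [map_sum, map_smul]
  exact h4 (mfderiv 𝓘(ℝ, E) 𝓘(ℝ, E) (fun x : G => g * x) 1)

/-- Translating an integral curve to the identity. -/
theorem IsMIntegralCurve.hasMFDerivAt_inv_mul [LieGroup 𝓘(ℝ, E) ∞ G] {w : G → E} {k : ℝ → G}
    (hk : IsMIntegralCurve (I := 𝓘(ℝ, E)) k fun g =>
      mulInvariantVectorField (show GroupLieAlgebra 𝓘(ℝ, E) G from w g) g) (t : ℝ) :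
    HasMFDerivAt 𝓘(ℝ, ℝ) 𝓘(ℝ, E) (fun s => (k t)⁻¹ * k s) t
      ((1 : ℝ →L[ℝ] ℝ).smulRight (w (k t))) := by
  have h1 := hasMFDerivAt_comp_of_eq (hasMFDerivAt_mul_left (E := E) (k t)⁻¹ (k t)) (hk t) rfl
  have h2 := hasMFDerivAt_comp_of_eq (hasMFDerivAt_mul_left (E := E) (k t)⁻¹ (k t))
    (hasMFDerivAt_mul_left (E := E) (k t) 1) (mul_one _)
  have h3 : (fun x => (k t)⁻¹ * x) ∘ (fun x => k t * x) = id := by ext x; simp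
  rw [h3] at h2
  have h4 := fun v => hasMFDerivAt_unique_apply h2 (hasMFDerivAt_id (1 : G)) v
  have h5 : ∀ A B : E →L[ℝ] E, (∀ v, A (B v) = v) → ∀ v,
      A.comp ((1 : ℝ →L[ℝ] ℝ).smulRight (B v)) = (1 : ℝ →L[ℝ] ℝ).smulRight v :=
    fun A B h v => by ext; simp [h]
  have h6 := h5 _ _ h4 (w (k t))
  exact h6 ▸ h1

variable {EK : Type*} [NormedAddCommGroup EK] [NormedSpace ℝ EK] [FiniteDimensional ℝ EK]
variable {K : Subgroup G} [ChartedSpace EK K]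
variable [FiniteDimensional ℝ E] [LieGroup 𝓘(ℝ, E) ∞ G] [LieGroup 𝓘(ℝ, EK) ∞ K]

/-- The Hamiltonian flow of a collective function is given by the adjoint action of a curve in the
subgroup. -/
theorem exists_curve_hasDerivAt_Ad [T2Space K] [CompactSpace K] (B : AdInvariantInner E G)
    (hK : IsLieSubgroup (E := E) (EK := EK) K) {F : EK → ℝ} (hF : ContDiff ℝ ∞ F) (Z : E) :
    ∃ k : ℝ → K, k 0 = 1 ∧ ∀ t, HasDerivAt (fun s => (Ad (E := E) (k s : G)⁻¹ Z : E))
      (lieBr (E := E) G (lieIncl K (lieGrad B K F (momentMap B K (Ad (k t : G)⁻¹ Z))))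
        (Ad (k t : G)⁻¹ Z)) t := by
  have hAd : ContMDiff 𝓘(ℝ, EK) 𝓘(ℝ, E) ∞ (fun k : K => (Ad (E := E) (k : G)⁻¹ Z : E)) :=
    (contMDiff_Ad_apply Z).comp hK.contMDiff_val.inv
  -- Along `k' = k · w(k)` the curve `Ad(k⁻¹)Z` has velocity `-[w, Ad(k⁻¹)Z]`; hence the sign. With
  -- `Z` fixed, `w` depends on `k` alone, so the equation on `K` is autonomous.
  let w : K → EK := fun k => -lieGrad B K F (momentMap B K (Ad (k : G)⁻¹ Z))
  have hw : ContMDiff 𝓘(ℝ, EK) 𝓘(ℝ, EK) ∞ w :=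
    (((contDiff_lieGrad B hK hF).comp (contDiff_momentMap B hK)).neg).contMDiff.comp hAd
  have : IsManifold 𝓘(ℝ, EK) 1 K := .of_le (n := ∞) (by simp)
  have : CompleteSpace EK := FiniteDimensional.complete ℝ EK
  obtain ⟨k, hk0, hk⟩ := exists_isMIntegralCurve_of_compactSpace
    (contMDiff_mulInvariantVectorField_apply (hw.of_le (by simp))) 1
  refine ⟨k, hk0, fun t => ?_⟩
  have h1 := hasDerivAt_Ad_inv (hK.hasMFDerivAt_coe (hk.hasMFDerivAt_inv_mul t)
    (inv_mul_cancel _)) (by simp) (Ad (E := E) (k t : G)⁻¹ Z)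
  have h2 : ∀ s, Ad (E := E) (((k t)⁻¹ * k s : K) : G)⁻¹ (Ad (E := E) (k t : G)⁻¹ Z) =
      Ad (E := E) (k s : G)⁻¹ Z := fun s => by
    rw [← Ad_mul]; simp
  simp only [h2] at h1
  have h3 : lieIncl (E := E) K (w (k t)) =
    -lieIncl (E := E) K (lieGrad B K F (momentMap B K (Ad (k t : G)⁻¹ Z))) := map_neg _ _
  rw [h3, lieBr_neg_left, neg_neg] at h1
  exact h1

/-- Solutions of the linear equation `c' = [ξ, c]` are determined by their initial values. -/
theorem AdInvariantInner.eq_of_hasDerivAt_lieBr (B : AdInvariantInner E G) {ξ c γ : ℝ → E}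
    (hc : ∀ t, HasDerivAt c (lieBr (E := E) G (ξ t) (c t)) t)
    (hγ : ∀ t, HasDerivAt γ (lieBr (E := E) G (ξ t) (γ t)) t) (h0 : c 0 = γ 0) : c = γ := by
  let b : E →L[ℝ] E →L[ℝ] ℝ :=
    LinearMap.toContinuousLinearMap (LinearMap.toContinuousLinearMap.toLinearMap ∘ₗ B.form)
  -- The difference solves the same linear equation and `ad ξ` is skew, so its squared length is
  -- constant. No continuity of `ξ` is required.
  have hd : ∀ t, HasDerivAt (fun s => b (c s - γ s) (c s - γ s)) 0 t := fun t => by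
    have h1 := (hc t).sub (hγ t)
    have h2 := (b.hasFDerivAt.comp_hasDerivAt t h1).clm_apply h1
    have h3 : lieBr (E := E) G (ξ t) (c t) - lieBr (E := E) G (ξ t) (γ t) =
      lieBr (E := E) G (ξ t) (c t - γ t) := (lieBr_sub_right _ _ _).symm
    have h4 : b (lieBr (E := E) G (ξ t) (c t - γ t)) (c t - γ t) +
        b (c t - γ t) (lieBr (E := E) G (ξ t) (c t - γ t)) = 0 := by
      have := B.form_lieBr_left (ξ t) (c t - γ t) (c t - γ t)
      exact (congrArg (· + B.form (c t - γ t) (lieBr (E := E) G (ξ t) (c t - γ t))) this).trans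
        (neg_add_cancel _)
    rw [h3] at h2
    exact h4 ▸ h2
  have hconst := is_const_of_deriv_eq_zero (fun t => (hd t).differentiableAt)
    fun t => (hd t).deriv
  ext t
  by_contra hne
  have hpos := B.pos (c t - γ t) (sub_ne_zero.2 hne)
  have := hconst t 0
  simp only [h0, sub_self, map_zero] at this
  exact hpos.ne' this

end Flow

/-! ### Unitary representations and their spectral invariants -/

section Representation

open Filter Topology

variable {E : Type*} [NormedAddCommGroup E] [NormedSpace ℝ E]
variable {K : Type*} [TopologicalSpace K] [ChartedSpace E K] [Group K]
variable {V : Type*} [NormedAddCommGroup V] [InnerProductSpace ℂ V]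

theorem IsSmoothRep.hasMFDerivAt {ρ : K →* (V ≃ₗᵢ[ℂ] V)} (hρ : IsSmoothRep (EK := E) ρ) :
    HasMFDerivAt 𝓘(ℝ, E) 𝓘(ℝ, V →L[ℂ] V) (repOp ρ) 1 (repDeriv (EK := E) ρ) :=
  (hρ.mdifferentiable (by simp) 1).hasMFDerivAt

variable [LieGroup 𝓘(ℝ, E) ∞ K]

/-- The differential of a representation intertwines the adjoint actions. -/
theorem IsSmoothRep.repDeriv_Ad {ρ : K →* (V ≃ₗᵢ[ℂ] V)} (hρ : IsSmoothRep (EK := E) ρ) (k : K)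
    (X : LieAlg E K) : (repDeriv (EK := E) ρ (Ad k X)).toLinearMap =
      (ρ k).toLinearEquiv.conj (repDeriv (EK := E) ρ X).toLinearMap := by
  let T : (V →L[ℂ] V) →L[ℝ] (V →L[ℂ] V) :=
    ((ContinuousLinearMap.mul ℂ (V →L[ℂ] V) (repOp ρ k)) ∘L
      ((ContinuousLinearMap.mul ℂ (V →L[ℂ] V)).flip (repOp ρ k⁻¹))).restrictScalars ℝ
  have h1 := hasMFDerivAt_comp_of_eq hρ.hasMFDerivAt (hasMFDerivAt_conj (E := E) k) (by simp)
  have h2 := hasMFDerivAt_comp_of_eq T.hasFDerivAt.hasMFDerivAt hρ.hasMFDerivAt rfl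
  have h3 : repOp ρ ∘ (fun x => k * x * k⁻¹) = T ∘ repOp ρ := by
    ext x v
    simp [T, repOp]
  rw [h3] at h1
  have h4 := hasMFDerivAt_unique_apply h1 h2 X
  ext v
  have h5 := congrArg (fun S : V →L[ℂ] V => S v) h4
  refine h5.trans ?_
  simp [T, repOp, LinearEquiv.conj_apply]
  rfl

/-- The differential of a unitary representation is skew-adjoint. -/
theorem IsSmoothRep.inner_repDeriv_add {ρ : K →* (V ≃ₗᵢ[ℂ] V)} (hρ : IsSmoothRep (EK := E) ρ)
    (X : LieAlg E K) (v w : V) :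
    inner ℂ (repDeriv (EK := E) ρ X v) w + inner ℂ v (repDeriv (EK := E) ρ X w) = 0 := by
  obtain ⟨c, hc0, hc⟩ := exists_hasMFDerivAt_one (G := K) X
  have hd : ∀ u, HasDerivAt (fun s => repOp ρ (c s) u) (repDeriv (EK := E) ρ X u) 0 := fun u =>
    ((ContinuousLinearMap.apply ℂ V u).restrictScalars ℝ).hasFDerivAt.comp_hasDerivAt (0 : ℝ)
      (hasDerivAt_of_hasMFDerivAt hρ.hasMFDerivAt hc hc0)
  have h1 := (hd v).inner ℂ (hd w)
  have h2 := h1.unique ((hasDerivAt_const (0 : ℝ) (inner ℂ v w)).congr_of_eventuallyEq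
    (Eventually.of_forall fun s => (ρ (c s)).inner_map_map v w))
  have h3 : ∀ u, repOp ρ (c 0) u = u := fun u => by simp [hc0, repOp]
  rw [h3, h3, add_comm] at h2
  exact h2

/-- The power traces of a unitary representation are real up to a power of `i`. -/
theorem IsSmoothRep.im_trace_pow [FiniteDimensional ℂ V] {ρ : K →* (V ≃ₗᵢ[ℂ] V)}
    (hρ : IsSmoothRep (EK := E) ρ) (X : LieAlg E K) (m : ℕ) :
    (Complex.I ^ m *
      LinearMap.trace ℂ V ((repDeriv (EK := E) ρ X).toLinearMap ^ m)).im = 0 := by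
  -- `i ρ_*(X)` is self-adjoint since `ρ_*(X)` is skew; the diagonal entries of its powers are
  -- therefore real.
  have hs : (Complex.I • (repDeriv (EK := E) ρ X).toLinearMap).IsSymmetric := fun v w => by
    have h := hρ.inner_repDeriv_add X v w
    simp only [LinearMap.smul_apply, ContinuousLinearMap.coe_coe, inner_smul_left,
      inner_smul_right, Complex.conj_I]
    linear_combination (-Complex.I) * h
  rw [← smul_eq_mul, ← map_smul, ← smul_pow,
    LinearMap.trace_eq_sum_inner _ (stdOrthonormalBasis ℂ V), Complex.im_sum]
  refine Finset.sum_eq_zero fun i _ => ?_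
  exact (hs.pow m).im_inner_self_apply _

end Representation

section Invariants

variable {E : Type*} [NormedAddCommGroup E] [NormedSpace ℝ E]
variable {K : Type*} [TopologicalSpace K] [ChartedSpace E K] [Group K] [LieGroup 𝓘(ℝ, E) ∞ K]
variable {V : Type*} [NormedAddCommGroup V] [InnerProductSpace ℂ V]
variable {ρ : K →* (V ≃ₗᵢ[ℂ] V)} (hρ : IsSmoothRep (EK := E) ρ)

include hρ

/-- `Ad k` becomes conjugation by `ρ k`, an algebra automorphism, which commutes with powers and
preserves traces. -/
theorem IsSmoothRep.trace_pow_Ad (k : K) (X : LieAlg E K) (m : ℕ) :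
    LinearMap.trace ℂ V ((repDeriv (EK := E) ρ (Ad k X)).toLinearMap ^ m) =
      LinearMap.trace ℂ V ((repDeriv (EK := E) ρ X).toLinearMap ^ m) := by
  rw [hρ.repDeriv_Ad]
  exact (congrArg (LinearMap.trace ℂ V) (map_pow ((ρ k).toLinearEquiv.conjAlgEquiv ℂ)
    (repDeriv (EK := E) ρ X).toLinearMap m).symm).trans (LinearMap.trace_conj' _ _)

theorem IsSmoothRep.det_smul_one_sub_Ad (k : K) (X : LieAlg E K) (z : ℂ) :
    LinearMap.det (z • (1 : V →ₗ[ℂ] V) - (repDeriv (EK := E) ρ (Ad k X)).toLinearMap) =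
      LinearMap.det (z • (1 : V →ₗ[ℂ] V) - (repDeriv (EK := E) ρ X).toLinearMap) := by
  rw [hρ.repDeriv_Ad]
  refine Eq.trans (congrArg LinearMap.det ?_) (LinearMap.det_conj _ (ρ k).toLinearEquiv)
  ext v
  simp [LinearEquiv.conj_apply_apply]

end Invariants

/-! ### Connectedness of the orbit -/

section Orbit

variable {E : Type*} [NormedAddCommGroup E] [NormedSpace ℝ E]
variable {G : Type*} [TopologicalSpace G] [ChartedSpace E G] [Group G] [LieGroup 𝓘(ℝ, E) ∞ G]

theorem Ad_mem_adOrbit {Λ Z : LieAlg E G} (hZ : Z ∈ adOrbit (G := G) Λ) (g : G) :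
    Ad g Z ∈ adOrbit (G := G) Λ := by
  obtain ⟨h, rfl⟩ := hZ
  exact ⟨g * h, (Ad_mul g h Λ).symm⟩

theorem isConnected_adOrbit [ConnectedSpace G] (Λ : LieAlg E G) :
    IsConnected (adOrbit (G := G) Λ) := by
  have h : adOrbit (G := G) Λ = range fun g : G => Ad g Λ := by
    ext Z
    exact ⟨fun ⟨g, hg⟩ => ⟨g, hg.symm⟩, fun ⟨g, hg⟩ => ⟨g, hg.symm⟩⟩
  rw [h]
  exact isConnected_range (contMDiff_Ad_apply Λ).continuous

end Orbit

/-! ### Trajectories and the Lax equation -/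

section LaxUniqueness

variable {E : Type*} [NormedAddCommGroup E] [NormedSpace ℝ E]
variable {G : Type*} [TopologicalSpace G] [ChartedSpace E G] [Group G]
variable {EK : Type*} [NormedAddCommGroup EK] [NormedSpace ℝ EK] [FiniteDimensional ℝ EK]
variable {K : Subgroup G} [ChartedSpace EK K] [LieGroup 𝓘(ℝ, EK) ∞ K]

/-- Solutions of the Lax equation are determined by their initial values. -/
theorem SatisfiesLax.unique {B : AdInvariantInner E G} (hK : IsLieSubgroup (E := E) (EK := EK) K)
    {F : LieAlg EK K → ℝ} (hF : ContDiff ℝ ∞ F) {l l' : ℝ → LieAlg EK K}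
    (hl : SatisfiesLax K l fun t => lieGrad B K F (l t))
    (hl' : SatisfiesLax K l' fun t => lieGrad B K F (l' t)) (h : l 0 = l' 0) : l = l' := by
  have hd : ∀ {l : ℝ → LieAlg EK K}, SatisfiesLax K l (fun t => lieGrad B K F (l t)) →
      ∀ t, HasDerivAt l (-lieBr K (l t) (lieGrad B K F (l t))) t := fun hl t => by
    rw [← eq_neg_of_add_eq_zero_left (hl t).2]
    exact (hl t).1.hasDerivAt
  exact ContDiff.eq_of_forall_hasDerivAt (f := fun X : EK =>
    (-lieBr (E := EK) K X (lieGrad B K F X) : EK))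
    ((contDiff_id.lieBr (G := K) (contDiff_lieGrad B hK hF)).neg.of_le (by simp)) (hd hl) (hd hl') h

end LaxUniqueness

section Lax

variable {E : Type*} [NormedAddCommGroup E] [NormedSpace ℝ E] [FiniteDimensional ℝ E]
variable {G : Type*} [TopologicalSpace G] [ChartedSpace E G] [Group G] [LieGroup 𝓘(ℝ, E) ∞ G]
variable {EK : Type*} [NormedAddCommGroup EK] [NormedSpace ℝ EK] [FiniteDimensional ℝ EK]
variable {K : Subgroup G} [ChartedSpace EK K]
variable {B : AdInvariantInner E G} (hK : IsLieSubgroup (E := E) (EK := EK) K)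
variable {Λ : LieAlg E G} {F : LieAlg EK K → ℝ} (hF : ContDiff ℝ ∞ F)

include hK hF

theorem isHamiltonianTrajectory_iff {γ : ℝ → LieAlg E G} :
    IsHamiltonianTrajectory B Λ (F ∘ momentMap B K) γ ↔
      ∀ t, γ t ∈ adOrbit (G := G) Λ ∧ HasDerivAt γ
        (lieBr G (lieIncl K (lieGrad B K F (momentMap B K (γ t)))) (γ t)) t := by
  refine forall_congr' fun t => and_congr_right fun _ => ?_
  simp only [isHamiltonianVector_iff B hK hF, exists_eq_left]

/-- The formula for the Hamiltonian field extends smoothly from the orbit to all of `E`, so no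
manifold structure on the orbit is needed. -/
theorem IsHamiltonianTrajectory.unique {γ γ' : ℝ → LieAlg E G}
    (hγ : IsHamiltonianTrajectory B Λ (F ∘ momentMap B K) γ)
    (hγ' : IsHamiltonianTrajectory B Λ (F ∘ momentMap B K) γ') (h : γ 0 = γ' 0) : γ = γ' := by
  rw [isHamiltonianTrajectory_iff hK hF] at hγ hγ'
  have hξ : ContDiff ℝ ∞ fun Z : E =>
      (lieIncl (E := E) K (lieGrad B K F (momentMap B K Z)) : E) :=
    (lieIncl (E := E) (EK := EK) K).contDiff.comp
      ((contDiff_lieGrad B hK hF).comp (contDiff_momentMap B hK))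
  exact ContDiff.eq_of_forall_hasDerivAt (f := fun Z : E =>
    (lieBr (E := E) G (lieIncl K (lieGrad B K F (momentMap B K Z))) Z : E))
    ((hξ.lieBr (G := G) contDiff_id).of_le (by simp)) (fun t => (hγ t).2) (fun t => (hγ' t).2) h

variable [LieGroup 𝓘(ℝ, EK) ∞ K]

theorem exists_isHamiltonianTrajectory_Ad [T2Space K] [CompactSpace K] {Z : LieAlg E G}
    (hZ : Z ∈ adOrbit (G := G) Λ) :
    ∃ k : ℝ → K, k 0 = 1 ∧
      IsHamiltonianTrajectory B Λ (F ∘ momentMap B K) fun t => Ad (k t : G)⁻¹ Z := by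
  obtain ⟨k, hk0, hk⟩ := exists_curve_hasDerivAt_Ad B hK hF Z
  refine ⟨k, hk0, (isHamiltonianTrajectory_iff hK hF).2 fun t => ⟨Ad_mem_adOrbit hZ _, hk t⟩⟩

/-- A Hamiltonian trajectory of a collective function is moved by the subgroup. -/
theorem IsHamiltonianTrajectory.exists_eq_Ad [T2Space K] [CompactSpace K] {γ : ℝ → LieAlg E G}
    (hγ : IsHamiltonianTrajectory B Λ (F ∘ momentMap B K) γ) :
    ∃ k : ℝ → K, ∀ t, γ t = Ad (k t : G) (γ 0) := by
  obtain ⟨k, hk0, hk⟩ := exists_isHamiltonianTrajectory_Ad (B := B) hK hF (hγ 0).1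
  have h := hγ.unique hK hF hk (by simp [hk0, Ad_one])
  refine ⟨fun t => (k t)⁻¹, fun t => ?_⟩
  conv_lhs => rw [h]
  rfl

/-- Apply the linear map `Φ_K` to `γ' = [P_K, γ]` and use `momentMap_lieBr`; antisymmetry gives the
sign. -/
theorem IsHamiltonianTrajectory.hasDerivAt_momentMap {γ : ℝ → LieAlg E G}
    (hγ : IsHamiltonianTrajectory B Λ (F ∘ momentMap B K) γ) (t : ℝ) :
    HasDerivAt (fun s => (momentMap B K (γ s) : EK))
      (-lieBr K (momentMap B K (γ t)) (lieGrad B K F (momentMap B K (γ t)))) t := by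
  have h := (hasFDerivAt_momentMap B hK (γ t)).comp_hasDerivAt t
    ((isHamiltonianTrajectory_iff hK hF).1 hγ t).2
  rw [momentMapL_apply, momentMap_lieBr B hK, lieBr_swap] at h
  exact h

theorem IsHamiltonianTrajectory.satisfiesLax {γ : ℝ → LieAlg E G}
    (hγ : IsHamiltonianTrajectory B Λ (F ∘ momentMap B K) γ) :
    SatisfiesLax K (fun t => momentMap B K (γ t))
      (fun t => lieGrad B K F (momentMap B K (γ t))) := fun t => by
  have h := hγ.hasDerivAt_momentMap hK hF t
  exact ⟨h.differentiableAt, by rw [h.deriv]; exact neg_add_cancel _⟩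

end Lax

theorem theorem4p3
    {E : Type*} [NormedAddCommGroup E] [NormedSpace ℝ E] [FiniteDimensional ℝ E]
    {G : Type*} [TopologicalSpace G] [ChartedSpace E G] [Group G] [LieGroup 𝓘(ℝ, E) ∞ G]
    [T2Space G] [CompactSpace G] [ConnectedSpace G]
    (B : AdInvariantInner E G) (Λ : LieAlg E G)
    {EK : Type*} [NormedAddCommGroup EK] [NormedSpace ℝ EK] [FiniteDimensional ℝ EK]
    (K : Subgroup G) [ChartedSpace EK K] [LieGroup 𝓘(ℝ, EK) ∞ K]
    (hKsub : IsLieSubgroup (E := E) (EK := EK) K)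
    (hKclosed : IsClosed (K : Set G)) (hKconn : IsConnected (K : Set G)) :
    -- the Hamiltonian system of `Φ_K^* F` on `O(Λ)` is determined by the Lax equation
    (∀ F : LieAlg EK K → ℝ, ContDiff ℝ ∞ F →
      -- the Hamiltonian vector field exists, is unique, and is `[P_K, ·]`
      (∀ Z ∈ adOrbit (G := G) Λ, ∀ v : LieAlg E G,
        IsHamiltonianVector B (F ∘ momentMap B K) Z v ↔
          v = lieBr G (lieIncl K (lieGrad B K F (momentMap B K Z))) Z) ∧
      -- its flow is defined for all times
      (∀ Z ∈ adOrbit (G := G) Λ, ∃! γ : ℝ → LieAlg E G,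
        γ 0 = Z ∧ IsHamiltonianTrajectory B Λ (F ∘ momentMap B K) γ) ∧
      (∀ γ : ℝ → LieAlg E G, IsHamiltonianTrajectory B Λ (F ∘ momentMap B K) γ →
        -- the Lax equation for `L_K = Φ_K` and `P_K = ∇F(Φ_K)` along the flow
        SatisfiesLax K (fun t => momentMap B K (γ t))
          (fun t => lieGrad B K F (momentMap B K (γ t))) ∧
        -- evolution of the collective observables `Φ_K^* J`
        (∀ J : LieAlg EK K → ℝ, ContDiff ℝ ∞ J → ∀ t : ℝ,
          HasDerivAt (fun s => J (momentMap B K (γ s)))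
            (subForm B K (lieGrad B K J (momentMap B K (γ t)))
              (-(lieBr K (momentMap B K (γ t)) (lieGrad B K F (momentMap B K (γ t)))))) t) ∧
        -- the solution of the Lax equation with the given initial value determines the trajectory
        (∀ l : ℝ → LieAlg EK K, l 0 = momentMap B K (γ 0) →
          SatisfiesLax K l (fun t => lieGrad B K F (l t)) →
          (∀ t, l t = momentMap B K (γ t)) ∧
          ∀ c : ℝ → LieAlg E G, c 0 = γ 0 →
            (∀ t, HasDerivAt c (lieBr G (lieIncl K (lieGrad B K F (l t))) (c t)) t) → c = γ))) ∧
    -- the spectral invariants of the Lax matrix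
    (∃ U : Set (adOrbit (G := G) Λ), IsOpen U ∧ Dense U ∧ IsConnected U ∧
      ∀ (V : Type*) [NormedAddCommGroup V] [InnerProductSpace ℂ V] [FiniteDimensional ℂ V]
        (ρ : K →* (V ≃ₗᵢ[ℂ] V)), IsSmoothRep (EK := EK) ρ →
        -- `(√-1)^m Tr(ρ_*(L_K)^m)` is real
        (∀ Z ∈ U, ∀ m : ℕ,
          (Complex.I ^ m *
            LinearMap.trace ℂ V ((repDeriv (EK := EK) ρ (momentMap B K Z.1)).toLinearMap ^ m)).im = 0) ∧
        ∀ F : LieAlg EK K → ℝ, ContDiff ℝ ∞ F →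
        ∀ γ : ℝ → LieAlg E G, IsHamiltonianTrajectory B Λ (F ∘ momentMap B K) γ →
          γ 0 ∈ Subtype.val '' U → ∀ t : ℝ, γ t ∈ Subtype.val '' U ∧
            (∀ m : ℕ,
              Complex.I ^ m *
                  LinearMap.trace ℂ V ((repDeriv (EK := EK) ρ (momentMap B K (γ t))).toLinearMap ^ m) =
                Complex.I ^ m *
                  LinearMap.trace ℂ V ((repDeriv (EK := EK) ρ (momentMap B K (γ 0))).toLinearMap ^ m)) ∧
            (∀ z : ℂ,
              LinearMap.det (z • (1 : V →ₗ[ℂ] V) - (repDeriv (EK := EK) ρ (momentMap B K (γ t))).toLinearMap) =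
              LinearMap.det
                (z • (1 : V →ₗ[ℂ] V) - (repDeriv (EK := EK) ρ (momentMap B K (γ 0))).toLinearMap))) := by
  -- Compactness of `K`, inherited from `G`, is what makes the lifted flow complete.
  have : CompactSpace K := isCompact_iff_compactSpace.1 hKclosed.isCompact
  refine ⟨fun F hF => ⟨fun Z _ v => isHamiltonianVector_iff B hKsub hF Z v, fun Z hZ => ?_,
    fun γ hγ => ⟨hγ.satisfiesLax hKsub hF, fun J hJ t => ?_, fun l hl0 hl => ?_⟩⟩, ?_⟩
  · obtain ⟨k, hk0, hk⟩ := exists_isHamiltonianTrajectory_Ad (B := B) hKsub hF hZ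
    have h0 : Ad (k 0 : G)⁻¹ Z = Z := by simp [hk0, Ad_one]
    exact ⟨_, ⟨h0, hk⟩, fun γ hγ => hγ.2.unique hKsub hF hk (hγ.1.trans h0.symm)⟩
  · rw [subForm_lieGrad B hKsub]
    exact (hJ.differentiable (by simp) _).hasFDerivAt.comp_hasDerivAt t
      (hγ.hasDerivAt_momentMap hKsub hF t)
  · have hl' := SatisfiesLax.unique hKsub hF hl (hγ.satisfiesLax hKsub hF) hl0
    refine ⟨fun t => congrFun hl' t, fun c hc0 hc => ?_⟩
    -- Once `l` is known to be `Φ_K ∘ γ`, both `c` and `γ` solve one linear equation with the same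
    -- coefficient.
    refine B.eq_of_hasDerivAt_lieBr hc (fun t => ?_) hc0
    rw [hl']
    exact ((isHamiltonianTrajectory_iff hKsub hF).1 hγ t).2
  · have : ConnectedSpace (adOrbit (G := G) Λ) :=
      isConnected_iff_connectedSpace.1 (isConnected_adOrbit Λ)
    -- Reality and conservation hold at every point, so the whole orbit is taken; it is connected
    -- because `G` is.
    refine ⟨univ, isOpen_univ, dense_univ, isConnected_univ, fun V _ _ _ ρ hρ =>
      ⟨fun Z _ m => hρ.im_trace_pow _ m, fun F hF γ hγ _ t => ?_⟩⟩
    obtain ⟨k, hk⟩ := hγ.exists_eq_Ad hKsub hF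
    have hL : momentMap B K (γ t) = Ad (E := EK) (k t) (momentMap B K (γ 0)) := by
      rw [hk t, momentMap_Ad B hKsub]
    refine ⟨⟨⟨γ t, (hγ t).1⟩, mem_univ _, rfl⟩, fun m => ?_, fun z => ?_⟩
    · rw [hL, hρ.trace_pow_Ad]
    · rw [hL, hρ.det_smul_one_sub_Ad]
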